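/- An order unit space $(V,C,u)$ is a real vector space $V$ with an Archimedean cone $C$ (with $C\cap -C=\{0\}$) and an order unit $u$; it carries the order unit norm $\|v\|_u=\inf\{\lambda\ge 0:-\lambda u\le v\le\lambda u\}$, it is called complete if this norm is complete, and $C^\circ$ is the interior of $C$. For $v\in V$ and $w\in C^\circ$ put $M(v/w)=\inf\{\mu\in\mathbb{R}: v\le\mu w\}$. A bijection $\Psi\colon C^\circ\to K^\circ$ between the interiors of the cones of two order unit spaces $(V,C,u)$, $(W,K,e)$ is gauge-reversing if $M(v/w)=M(\Psi(w)/\Psi(v))$ for all $v,w\in C^\circ$. An extreme vector of $C$ is a nonzero $p\in C$ such that $0\le v\le p$ implies $v=\lambda p$ for some $\lambda\ge 0$; it is an atom of $C$ if $M(p/u)=1$. The state space $S=S(V)$ is the set of positive linear functionals $\varphi$ on $V$ with $\varphi(u)=1$, with the $w^*$-topology; pure states are the extreme points of the state space. Let $A_{usc}(S)^+$ be the set of nonnegative bounded affine $w^*$-upper semicontinuous functions on $S$, and let $C_{sc}$ be the set of nonnegative functions on $S$ of the form $g-h$ with $g,h\in A_{usc}(S)^+$. We write $C=C_{sc}$ if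 $C_{sc}=\{\hat x: x\in C\}$, where $\hat x(\varphi)=\varphi(x)$. **Theorem.** Let $(V,C,u)$ and $(W,K,e)$ be complete order unit spaces with $C=C_{sc}$, and let $\Psi\colon C^\circ\to K^\circ$ be a gauge-reversing map with $\Psi(u)=e$. Then: (i) For each atom $p$ of $C$ there is a unique atom $q$ of $K$ such that $u+\lambda p\in C^\circ$ and $\Psi(u+\lambda p)=e-\frac{\lambda}{\lambda+1}q$ for all $\lambda>-1$, and $p\mapsto q$ is a bijection from the atoms of $C$ onto the atoms of $K$. (ii) For each atom $p$ of $C$ there is a unique pure state $\psi_p=\Psi^*(p)$ of $(W,K,e)$ such that $\log M(p/\Psi^{-1}(y))=\log\psi_p(y)$ for all $y\in K^\circ$, and $\Psi^*$ is a bijection from the atoms of $C$ onto the pure states of $(W,K,e)$. Moreover, for each atom $p$ of $C$, $M(p/x)=\psi_p(\Psi(x))$ for all $x\in C^\circ$, and $\psi_p(q)=1$, where $q$ is the atom of $K$ corresponding to $p$ in (i). -/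

import Mathlib

/-- The cone `C = {v | 0 ≤ v}` of an ordered vector space. -/
def posCone (V : Type*) [AddCommGroup V] [PartialOrder V] : Set V := {v | 0 ≤ v}

/-- `u` is an order unit: `u ∈ C`, and every `v` satisfies `-l u ≤ v ≤ l u` for some `l ≥ 0`. -/
def IsOrderUnit {V : Type*} [AddCommGroup V] [Module ℝ V] [PartialOrder V] (u : V) : Prop :=
  0 ≤ u ∧ ∀ v : V, ∃ l : ℝ, 0 ≤ l ∧ -(l • u) ≤ v ∧ v ≤ l • u

/-- The order unit norm `inf {l ≥ 0 | -l u ≤ v ≤ l u}`. -/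
noncomputable def orderUnitNorm {V : Type*} [AddCommGroup V] [Module ℝ V] [PartialOrder V]
    (u v : V) : ℝ :=
  sInf {l : ℝ | 0 ≤ l ∧ -(l • u) ≤ v ∧ v ≤ l • u}

/-- `(V, C, u)` is an order unit space: `C` is Archimedean and `u` is an order unit. The space
`V` carries its order unit norm: topological notions (interior, completeness, dual space)
refer to this norm. -/
structure IsOrderUnitSpace {V : Type*} [NormedAddCommGroup V] [NormedSpace ℝ V]
    [PartialOrder V] [IsOrderedAddMonoid V] [PosSMulMono ℝ V] (u : V) : Prop where
  archimedean : ∀ v w : V, 0 ≤ w → (∀ n : ℕ, n • v ≤ w) → v ≤ 0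
  orderUnit : IsOrderUnit u
  norm_eq : ∀ v : V, ‖v‖ = orderUnitNorm u v

/-- The order unit lies in the interior of the cone. -/
theorem IsOrderUnitSpace.unit_mem_interior {V : Type*} [NormedAddCommGroup V] [NormedSpace ℝ V]
    [PartialOrder V] [IsOrderedAddMonoid V] [PosSMulMono ℝ V] {u : V}
    (h : IsOrderUnitSpace u) : u ∈ interior (posCone V) := by
  rw [mem_interior_iff_mem_nhds, Metric.mem_nhds_iff]
  refine ⟨1, one_pos, fun v hv => ?_⟩
  rw [Metric.mem_ball, dist_eq_norm, h.norm_eq, orderUnitNorm] at hv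
  obtain ⟨l, ⟨_, hl, _⟩, hl1⟩ := exists_lt_of_csInf_lt (h.orderUnit.2 (v - u)) hv
  have h1 : 0 ≤ (1 - l) • u := smul_nonneg (by linarith) h.orderUnit.1
  have h2 : 0 ≤ (v - u) + l • u := by
    have := add_le_add_left hl (l • u)
    simpa using this
  have h3 : v = (1 - l) • u + ((v - u) + l • u) := by
    rw [sub_smul, one_smul]; abel
  change 0 ≤ v
  rw [h3]
  exact add_nonneg h1 h2

/-- The interior `C°` of the cone (for the order unit norm). -/
abbrev ConeInterior (V : Type*) [NormedAddCommGroup V] [PartialOrder V] : Type _ :=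
  ↥(interior (posCone V))

/-- The gauge `M(v/w) = inf {m ∈ ℝ | v ≤ m w}`. -/
noncomputable def gaugeM {V : Type*} [AddCommGroup V] [Module ℝ V] [PartialOrder V]
    (v w : V) : ℝ :=
  sInf {m : ℝ | v ≤ m • w}

/-- A bijection `Ψ : C° → K°` is gauge-reversing if `M(v/w) = M(Ψ(w)/Ψ(v))`. -/
def IsGaugeReversing {V W : Type*} [NormedAddCommGroup V] [NormedSpace ℝ V] [PartialOrder V]
    [NormedAddCommGroup W] [NormedSpace ℝ W] [PartialOrder W]
    (Ψ : ConeInterior V ≃ ConeInterior W) : Prop :=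
  ∀ v w : ConeInterior V, gaugeM (v : V) (w : V) = gaugeM (Ψ w : W) (Ψ v : W)

/-- Extreme vectors of the cone `C`. -/
def IsExtremeVector {V : Type*} [AddCommGroup V] [Module ℝ V] [PartialOrder V] (r : V) : Prop :=
  r ≠ 0 ∧ 0 ≤ r ∧ ∀ v : V, 0 ≤ v → v ≤ r → ∃ l : ℝ, 0 ≤ l ∧ v = l • r

/-- The atoms of the cone: extreme vectors `p` with `M(p/u) = 1`. -/
def coneAtoms {V : Type*} [AddCommGroup V] [Module ℝ V] [PartialOrder V] (u : V) : Set V :=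
  {p | IsExtremeVector p ∧ gaugeM p u = 1}

/-- The state space `S`, as a subset of the dual space with its weak-star topology. -/
def stateSpace {V : Type*} [NormedAddCommGroup V] [NormedSpace ℝ V] [PartialOrder V] (u : V) :
    Set (WeakDual ℝ V) :=
  {φ | (∀ v : V, 0 ≤ v → 0 ≤ φ v) ∧ φ u = 1}

/-- The pure states: extreme points of the state space. -/
def pureStates {V : Type*} [NormedAddCommGroup V] [NormedSpace ℝ V] [PartialOrder V] (u : V) :
    Set (WeakDual ℝ V) :=
  (stateSpace u).extremePoints ℝ

/-- Affine real functions on the state space. -/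
def IsAffineOnStates {V : Type*} [NormedAddCommGroup V] [NormedSpace ℝ V] [PartialOrder V]
    (u : V) (f : stateSpace u → ℝ) : Prop :=
  ∀ (φ ψ χ : stateSpace u) (t : ℝ), 0 ≤ t → t ≤ 1 →
    (χ : WeakDual ℝ V) = t • (φ : WeakDual ℝ V) + (1 - t) • (ψ : WeakDual ℝ V) →
    f χ = t * f φ + (1 - t) * f ψ

/-- `A_usc(S)⁺`: nonnegative bounded affine weak-star upper semicontinuous functions on `S`. -/
def affineUscPos {V : Type*} [NormedAddCommGroup V] [NormedSpace ℝ V] [PartialOrder V]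
    (u : V) : Set (stateSpace u → ℝ) :=
  {f | IsAffineOnStates u f ∧ UpperSemicontinuous f ∧ (∃ B : ℝ, ∀ φ, |f φ| ≤ B) ∧ ∀ φ, 0 ≤ f φ}

/-- `C_sc = (A_usc(S)⁺ - A_usc(S)⁺)⁺`. -/
def coneSc {V : Type*} [NormedAddCommGroup V] [NormedSpace ℝ V] [PartialOrder V]
    (u : V) : Set (stateSpace u → ℝ) :=
  {f | (∀ φ, 0 ≤ f φ) ∧ ∃ g ∈ affineUscPos u, ∃ h ∈ affineUscPos u, f = g - h}

/-- The function `φ ↦ φ x` on the state space. -/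
noncomputable def stateEval {V : Type*} [NormedAddCommGroup V] [NormedSpace ℝ V] [PartialOrder V]
    (u : V) (x : V) : stateSpace u → ℝ :=
  fun φ => (φ : WeakDual ℝ V) x

/-- `C = C_sc`, where `x ∈ C` is identified with the function `φ ↦ φ x` on the state space. -/
def ConeEqConeSc {V : Type*} [NormedAddCommGroup V] [NormedSpace ℝ V] [PartialOrder V]
    (u : V) : Prop :=
  stateEval u '' posCone V = coneSc u

/-- The function `h_p(x) = log M(p/x)` on `C°`. -/
noncomputable def logGauge {V : Type*} [NormedAddCommGroup V] [NormedSpace ℝ V] [PartialOrder V]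
    (p : V) : ConeInterior V → ℝ :=
  fun x => Real.log (gaugeM p (x : V))

/-- The extension of `Ψ` to functions: `Ψ(h)(y) = h(Ψ⁻¹(y))` for `y ∈ K°`. -/
def pushforwardFun {V W : Type*} [NormedAddCommGroup V] [PartialOrder V]
    [NormedAddCommGroup W] [PartialOrder W]
    (Ψ : ConeInterior V ≃ ConeInterior W) (h : ConeInterior V → ℝ) : ConeInterior W → ℝ :=
  fun y => h (Ψ.symm y)

/-- `ψ` is the functional that `Ψ*` attaches to `p`: `Ψ(h_p) = log ψ` on `K°`. -/
def IsPsiStar {V W : Type*} [NormedAddCommGroup V] [NormedSpace ℝ V] [PartialOrder V]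
    [NormedAddCommGroup W] [NormedSpace ℝ W] [PartialOrder W]
    (Ψ : ConeInterior V ≃ ConeInterior W) (p : V) (ψ : WeakDual ℝ W) : Prop :=
  ∀ y : ConeInterior W, pushforwardFun Ψ (logGauge p) y = Real.log (ψ (y : W))

/-- `q` corresponds to `p` under `Ψ`: for all `t > -1`, `u + t p ∈ C°` and
`Ψ(u + t p) = e - (t / (t + 1)) q`. -/
def Corresponds {V W : Type*} [NormedAddCommGroup V] [NormedSpace ℝ V] [PartialOrder V]
    [NormedAddCommGroup W] [NormedSpace ℝ W] [PartialOrder W]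
    (Ψ : ConeInterior V ≃ ConeInterior W) (u : V) (e : W) (p : V) (q : W) : Prop :=
  ∀ t : ℝ, -1 < t → ∃ h : u + t • p ∈ interior (posCone V),
    (Ψ ⟨u + t • p, h⟩ : W) = e - (t / (t + 1)) • q

/-! By the Archimedean property infima of gauges are attained, so gauge reversal is an order
statement: `Ψ` is an antitone bijection, homogeneous of degree -1.

For the atoms, an order interval `[a, a + t p]` with `p` extreme is a totally ordered segment. `Ψ`
maps it onto `[Ψ (a + t p), Ψ a]`, which is therefore totally ordered, and this forces the
difference of its endpoints to be extreme. So the line `u + t p` goes into a line `e - f q`, and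
comparison with multiples of the units gives `f = t / (t + 1)`. The inverse map supplies the inverse
bijection. The hypothesis `C = C_sc` plays no role here.

For the pure states, let `ψ` be pure. The set `{ψ < 1}` is upward directed, so its preimage under
`Ψ` in `C°` is downward directed, and `C = C_sc` supplies a pointwise infimum `p` in `C`. Dini's
argument gives `M(p/x) = ψ(Ψ x)` (`exists_gaugeM_eq_pureState`). If `0 ≤ v ≤ p`, then `y ↦ M(v/Ψ⁻¹
y)` is sublinear and dominated by `ψ`. A Hahn–Banach minorant is a multiple of `ψ` by purity, hence
`M(v/u) p ≤ v` (`gaugeM_smul_le_of_le`), which makes `p` an atom. Conversely, for an atom `p` with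
partner `q`, a pure state with `ψ q = 1` exists by Krein–Milman. The formula of (i) for large `t`
gives `ψ(Ψ x) ≤ M(p/x)`, so the atom attached to `ψ` lies below `p` and equals it. -/

/-! ### Order and gauge calculus in an order unit space. -/

section OrderUnit

set_option linter.unusedSectionVars false

variable {V : Type*} [NormedAddCommGroup V] [NormedSpace ℝ V]
  [PartialOrder V] [IsOrderedAddMonoid V] [PosSMulMono ℝ V] {u : V}

theorem real_smul_le_smul_right {a b : ℝ} (h : a ≤ b) {v : V} (hv : 0 ≤ v) : a • v ≤ b • v := by
  have := smul_nonneg (sub_nonneg.2 h) hv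
  rw [sub_smul] at this
  exact sub_nonneg.1 this

theorem real_smul_le_smul_left {a : ℝ} (ha : 0 ≤ a) {v w : V} (h : v ≤ w) : a • v ≤ a • w :=
  smul_le_smul_of_nonneg_left h ha

theorem le_of_real_smul_le {a : ℝ} (ha : 0 < a) {v w : V} (h : a • v ≤ a • w) : v ≤ w := by
  have := real_smul_le_smul_left (inv_nonneg.2 ha.le) h
  rwa [smul_smul, smul_smul, inv_mul_cancel₀ ha.ne', one_smul, one_smul] at this

theorem real_smul_le_iff {a : ℝ} (ha : 0 < a) {v w : V} : a • v ≤ w ↔ v ≤ a⁻¹ • w := by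
  constructor
  · intro h
    apply le_of_real_smul_le ha
    rwa [smul_smul, mul_inv_cancel₀ ha.ne', one_smul]
  · intro h
    have := real_smul_le_smul_left ha.le h
    rwa [smul_smul, mul_inv_cancel₀ ha.ne', one_smul] at this

namespace IsOrderUnitSpace

theorem le_of_forall_pos_le_add (hV : IsOrderUnitSpace u) {v w : V}
    (h : ∀ ε : ℝ, 0 < ε → v ≤ w + ε • u) : v ≤ w := by
  have := hV.archimedean (v - w) u hV.orderUnit.1 (fun n => ?_)
  · exact sub_nonpos.1 this
  rcases Nat.eq_zero_or_pos n with rfl | hn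
  · simpa using hV.orderUnit.1
  have hn' : (0 : ℝ) < n := by exact_mod_cast hn
  have h1 : v - w ≤ (n : ℝ)⁻¹ • u := sub_le_iff_le_add'.2 (h _ (inv_pos.2 hn'))
  rw [← real_smul_le_iff hn'] at h1
  rwa [Nat.cast_smul_eq_nsmul] at h1

theorem mem_interior_of_smul_le (hV : IsOrderUnitSpace u) {x : V} {d : ℝ} (hd : 0 < d)
    (h : d • u ≤ x) : x ∈ interior (posCone V) := by
  rw [mem_interior_iff_mem_nhds, Metric.mem_nhds_iff]
  refine ⟨d, hd, fun v hv => ?_⟩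
  rw [Metric.mem_ball, dist_eq_norm, hV.norm_eq, orderUnitNorm] at hv
  obtain ⟨l, ⟨_, hl, _⟩, hl1⟩ := exists_lt_of_csInf_lt (hV.orderUnit.2 (v - x)) hv
  have h1 : l • u ≤ d • u := real_smul_le_smul_right hl1.le hV.orderUnit.1
  have h2 : x - l • u ≤ v := by
    have := add_le_add_left hl x
    rw [sub_add_cancel] at this
    rwa [sub_eq_neg_add]
  change 0 ≤ v
  exact (sub_nonneg.2 (h1.trans h)).trans h2

theorem exists_smul_le (_hV : IsOrderUnitSpace u) {x : V} (hx : x ∈ interior (posCone V)) :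
    ∃ d : ℝ, 0 < d ∧ d • u ≤ x := by
  rw [mem_interior_iff_mem_nhds, Metric.mem_nhds_iff] at hx
  obtain ⟨r, hr, hb⟩ := hx
  have hu : 0 < ‖u‖ + 1 := by positivity
  refine ⟨r / (‖u‖ + 1), by positivity, ?_⟩
  have : x - (r / (‖u‖ + 1)) • u ∈ Metric.ball x r := by
    rw [Metric.mem_ball, dist_eq_norm, sub_sub_cancel_left, norm_neg, norm_smul,
      Real.norm_of_nonneg (by positivity), div_mul_eq_mul_div, div_lt_iff₀ hu]
    nlinarith
  exact sub_nonneg.1 (hb this)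

theorem nonneg_of_mem_interior {x : V} (hx : x ∈ interior (posCone V)) : 0 ≤ x :=
  interior_subset hx

theorem mem_interior_of_le (hV : IsOrderUnitSpace u) {x y : V} (hx : x ∈ interior (posCone V))
    (h : x ≤ y) : y ∈ interior (posCone V) := by
  obtain ⟨d, hd, hdx⟩ := hV.exists_smul_le hx
  exact hV.mem_interior_of_smul_le hd (hdx.trans h)

theorem smul_mem_interior (hV : IsOrderUnitSpace u) {x : V} (hx : x ∈ interior (posCone V))
    {c : ℝ} (hc : 0 < c) : c • x ∈ interior (posCone V) := by
  obtain ⟨d, hd, hdx⟩ := hV.exists_smul_le hx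
  refine hV.mem_interior_of_smul_le (mul_pos hc hd) ?_
  rw [mul_smul]
  exact real_smul_le_smul_left hc.le hdx

theorem add_smul_mem_interior (hV : IsOrderUnitSpace u) {v : V} (hv : 0 ≤ v)
    {c : ℝ} (hc : 0 < c) : v + c • u ∈ interior (posCone V) :=
  hV.mem_interior_of_smul_le hc (le_add_of_nonneg_left hv)

theorem exists_le_smul (hV : IsOrderUnitSpace u) {x : V} (hx : x ∈ interior (posCone V)) (v : V) :
    ∃ m : ℝ, 0 < m ∧ v ≤ m • x := by
  obtain ⟨d, hd, hdx⟩ := hV.exists_smul_le hx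
  obtain ⟨l, hl, -, hv⟩ := hV.orderUnit.2 v
  refine ⟨(l + 1) * d⁻¹, by positivity, ?_⟩
  rw [real_smul_le_iff hd] at hdx
  rw [mul_smul]
  exact hv.trans ((real_smul_le_smul_right (by linarith) hV.orderUnit.1).trans
    (real_smul_le_smul_left (by linarith) hdx))

theorem le_of_forall_pos_le_add_smul (hV : IsOrderUnitSpace u) {v w x : V}
    (h : ∀ ε : ℝ, 0 < ε → v ≤ w + ε • x) : v ≤ w := by
  obtain ⟨m, hm, hx⟩ := hV.exists_le_smul hV.unit_mem_interior x
  refine hV.le_of_forall_pos_le_add fun ε hε => ?_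
  refine (h (ε / m) (by positivity)).trans (add_le_add_right ?_ w)
  have := real_smul_le_smul_left (a := ε / m) (by positivity) hx
  rwa [smul_smul, div_mul_cancel₀ _ hm.ne'] at this

theorem not_nonpos_of_mem_interior (hV : IsOrderUnitSpace u) (hu : u ≠ 0) {x : V}
    (hx : x ∈ interior (posCone V)) : ¬ x ≤ 0 := by
  intro h0
  obtain ⟨d, hd, hdx⟩ := hV.exists_smul_le hx
  have := hdx.trans h0
  rw [real_smul_le_iff hd, smul_zero] at this
  exact hu (le_antisymm this hV.orderUnit.1)

theorem unit_ne_zero (hV : IsOrderUnitSpace u) {v : V} (hv : v ≠ 0) : u ≠ 0 := by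
  rintro rfl
  obtain ⟨l, -, h1, h2⟩ := hV.orderUnit.2 v
  simp only [smul_zero, neg_zero] at h1 h2
  exact hv (le_antisymm h2 h1)

/-- The infimum is attained by the Archimedean property. In the trivial space the defining set is
all of `ℝ` and `sInf` takes its default value 0, hence `u ≠ 0`. -/
theorem gaugeM_le_iff (hV : IsOrderUnitSpace u) (hu : u ≠ 0) (v : V) {x : V}
    (hx : x ∈ interior (posCone V)) {m : ℝ} : gaugeM v x ≤ m ↔ v ≤ m • x := by
  have hx0 := nonneg_of_mem_interior hx
  have hbdd : BddBelow {m : ℝ | v ≤ m • x} := by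
    obtain ⟨l, hl, hlv⟩ := hV.exists_le_smul hx (-v)
    refine ⟨-l, fun m hm => ?_⟩
    by_contra! hlt
    have h1 : 0 ≤ (m + l) • x := by
      rw [add_smul, ← neg_le_iff_add_nonneg]
      exact (neg_le.1 hlv).trans (show v ≤ m • x from hm)
    have h2 : (-(m + l)) • x ≤ 0 := by rw [neg_smul]; exact neg_nonpos.2 h1
    rw [real_smul_le_iff (by linarith), smul_zero] at h2
    exact hV.not_nonpos_of_mem_interior hu hx h2
  have hne : {m : ℝ | v ≤ m • x}.Nonempty := by
    obtain ⟨m, -, hm⟩ := hV.exists_le_smul hx v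
    exact ⟨m, hm⟩
  refine ⟨fun h => hV.le_of_forall_pos_le_add_smul (x := x) fun ε hε => ?_,
    fun h => csInf_le hbdd h⟩
  obtain ⟨r, hr, hr'⟩ := exists_lt_of_csInf_lt hne (lt_of_le_of_lt h (lt_add_of_pos_right m hε))
  rw [← add_smul]
  exact le_trans hr (real_smul_le_smul_right hr'.le hx0)

theorem le_gaugeM_smul (hV : IsOrderUnitSpace u) (hu : u ≠ 0) (v : V) {x : V}
    (hx : x ∈ interior (posCone V)) : v ≤ gaugeM v x • x :=
  (hV.gaugeM_le_iff hu v hx).1 le_rfl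

theorem gaugeM_mono (hV : IsOrderUnitSpace u) (hu : u ≠ 0) {v w x : V}
    (hx : x ∈ interior (posCone V)) (h : v ≤ w) : gaugeM v x ≤ gaugeM w x :=
  (hV.gaugeM_le_iff hu v hx).2 (h.trans (hV.le_gaugeM_smul hu w hx))

theorem gaugeM_add_le (hV : IsOrderUnitSpace u) (hu : u ≠ 0) (v w : V) {x : V}
    (hx : x ∈ interior (posCone V)) : gaugeM (v + w) x ≤ gaugeM v x + gaugeM w x := by
  rw [hV.gaugeM_le_iff hu _ hx, add_smul]
  exact add_le_add (hV.le_gaugeM_smul hu v hx) (hV.le_gaugeM_smul hu w hx)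

theorem gaugeM_smul_le (hV : IsOrderUnitSpace u) (hu : u ≠ 0) (v : V) {x : V}
    (hx : x ∈ interior (posCone V)) {c : ℝ} (hc : 0 ≤ c) : gaugeM (c • v) x ≤ c * gaugeM v x := by
  rw [hV.gaugeM_le_iff hu _ hx, mul_smul]
  exact real_smul_le_smul_left hc (hV.le_gaugeM_smul hu v hx)

theorem gaugeM_smul (hV : IsOrderUnitSpace u) (hu : u ≠ 0) (v : V) {x : V}
    (hx : x ∈ interior (posCone V)) {c : ℝ} (hc : 0 < c) : gaugeM (c • v) x = c * gaugeM v x := by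
  refine le_antisymm (hV.gaugeM_smul_le hu v hx hc.le) ?_
  have := hV.gaugeM_smul_le hu (c • v) hx (inv_pos.2 hc).le
  rw [smul_smul, inv_mul_cancel₀ hc.ne', one_smul, inv_mul_eq_div, le_div_iff₀ hc] at this
  linarith

theorem gaugeM_nonneg (hV : IsOrderUnitSpace u) (hu : u ≠ 0) {v : V} (hv : 0 ≤ v) {x : V}
    (hx : x ∈ interior (posCone V)) : 0 ≤ gaugeM v x := by
  by_contra! h
  have h1 := hv.trans (hV.le_gaugeM_smul hu v hx)
  have h2 : (-gaugeM v x) • x ≤ 0 := by rw [neg_smul]; exact neg_nonpos.2 h1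
  rw [real_smul_le_iff (by linarith), smul_zero] at h2
  exact hV.not_nonpos_of_mem_interior hu hx h2

theorem gaugeM_pos (hV : IsOrderUnitSpace u) (hu : u ≠ 0) {v : V} (hv : 0 ≤ v) (hv0 : v ≠ 0)
    {x : V} (hx : x ∈ interior (posCone V)) : 0 < gaugeM v x := by
  refine lt_of_le_of_ne (hV.gaugeM_nonneg hu hv hx) fun h => hv0 (le_antisymm ?_ hv)
  have := hV.le_gaugeM_smul hu v hx
  rwa [← h, zero_smul] at this

/-- The gauges `M(v/·)` determine the order. -/
theorem le_of_gaugeM_le (hV : IsOrderUnitSpace u) (hu : u ≠ 0) {v w : V} (hw : 0 ≤ w)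
    (h : ∀ x ∈ interior (posCone V), gaugeM v x ≤ gaugeM w x) : v ≤ w := by
  refine hV.le_of_forall_pos_le_add fun ε hε => ?_
  -- The test point `w + ε u` nearly touches `w` from above.
  have hx := hV.add_smul_mem_interior hw hε
  have h1 : gaugeM w (w + ε • u) ≤ 1 := by
    rw [hV.gaugeM_le_iff hu _ hx, one_smul]
    exact le_add_of_nonneg_right (smul_nonneg hε.le hV.orderUnit.1)
  have := (hV.gaugeM_le_iff hu _ hx).1 ((h _ hx).trans h1)
  rwa [one_smul] at this

theorem smul_le_smul_unit_iff (hV : IsOrderUnitSpace u) {q : V} (hq : 0 ≤ q)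
    (hu : u ≠ 0) (hq1 : gaugeM q u = 1) {c s : ℝ} (hs : 0 ≤ s) : c • q ≤ s • u ↔ c ≤ s := by
  rcases le_or_gt c 0 with hc | hc
  · refine iff_of_true ?_ (hc.trans hs)
    have h1 : c • q ≤ (0 : ℝ) • q := real_smul_le_smul_right hc hq
    rw [zero_smul] at h1
    exact h1.trans (smul_nonneg hs hV.orderUnit.1)
  · rw [real_smul_le_iff hc, smul_smul, ← hV.gaugeM_le_iff hu _ hV.unit_mem_interior, hq1,
      inv_mul_eq_div, one_le_div hc]

theorem add_smul_mem_interior_of_gaugeM_eq_one (hV : IsOrderUnitSpace u) (hu : u ≠ 0) {p : V}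
    (hp : 0 ≤ p) (hp1 : gaugeM p u = 1) {t : ℝ} (ht : -1 < t) :
    u + t • p ∈ interior (posCone V) := by
  have h1 : (-t) • p ≤ (max (-t) 0) • u :=
    (hV.smul_le_smul_unit_iff hp hu hp1 (le_max_right _ _)).2 (le_max_left _ _)
  refine hV.mem_interior_of_smul_le (d := 1 - max (-t) 0)
    (sub_pos.2 (max_lt (by linarith) one_pos)) ?_
  rw [sub_smul, one_smul, sub_eq_add_neg]
  refine add_le_add_right ?_ u
  rw [neg_smul] at h1
  exact neg_le.1 h1

end IsOrderUnitSpace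

end OrderUnit

/-- Hahn–Banach for the sublinear functional `a ↦ inf {r | R a r}`. -/
theorem exists_linearMap_le_of_rel {E : Type*} [AddCommGroup E] [Module ℝ E]
    (R : E → ℝ → Prop) (hadd : ∀ a b r s, R a r → R b s → R (a + b) (r + s))
    (hsmul : ∀ a r (c : ℝ), 0 < c → R a r → R (c • a) (c * r))
    (hex : ∀ a, ∃ r, R a r) (hzero : ∀ r, R 0 r → 0 ≤ r) {a₀ : E} (ha₀ : a₀ ≠ 0) :
    ∃ f : E →ₗ[ℝ] ℝ, (∀ a r, R a r → f a ≤ r) ∧ ∀ m, (∀ r, R a₀ r → m ≤ r) → m ≤ f a₀ := by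
  have hbdd : ∀ a, BddBelow {r | R a r} := fun a => by
    obtain ⟨s, hs⟩ := hex (-a)
    refine ⟨-s, fun r hr => ?_⟩
    have := hzero _ (add_neg_cancel a ▸ hadd _ _ _ _ hr hs)
    linarith
  set N : E → ℝ := fun a => sInf {r | R a r} with hN
  have hle : ∀ a r, R a r → N a ≤ r := fun a r h => csInf_le (hbdd a) h
  have hge : ∀ a m, (∀ r, R a r → m ≤ r) → m ≤ N a := fun a m h => le_csInf (hex a) h
  have hNadd : ∀ a b, N (a + b) ≤ N a + N b := fun a b => by
    refine le_of_forall_pos_le_add fun ε hε => ?_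
    obtain ⟨r, hr, hr'⟩ := exists_lt_of_csInf_lt (hex a) (lt_add_of_pos_right (N a) (half_pos hε))
    obtain ⟨s, hs, hs'⟩ := exists_lt_of_csInf_lt (hex b) (lt_add_of_pos_right (N b) (half_pos hε))
    have := hle _ _ (hadd _ _ _ _ hr hs)
    linarith
  have hNsmul_le : ∀ c : ℝ, 0 < c → ∀ a, N (c • a) ≤ c * N a := fun c hc a => by
    rw [← div_le_iff₀' hc]
    refine hge _ _ fun r hr => ?_
    rw [div_le_iff₀' hc]
    exact hle _ _ (hsmul _ _ _ hc hr)
  have hNsmul : ∀ c : ℝ, 0 < c → ∀ a, N (c • a) = c * N a := fun c hc a => by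
    refine le_antisymm (hNsmul_le c hc a) ?_
    have := hNsmul_le c⁻¹ (inv_pos.2 hc) (c • a)
    rwa [smul_smul, inv_mul_cancel₀ hc.ne', one_smul, inv_mul_eq_div, le_div_iff₀' hc] at this
  have hN0 : 0 ≤ N 0 := hge _ _ hzero
  obtain ⟨f, hf, hfN⟩ := exists_extension_of_le_sublinear
    (LinearPMap.mkSpanSingleton (K := ℝ) a₀ (N a₀) ha₀) N hNsmul hNadd (by
      rintro ⟨x, hx⟩
      obtain ⟨c, rfl⟩ := Submodule.mem_span_singleton.1 hx
      rw [LinearPMap.mkSpanSingleton'_apply, smul_eq_mul, RingHom.id_apply]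
      change _ ≤ N (c • a₀)
      -- For negative `c`, subadditivity on `c • a₀` and its negative, with `0 ≤ N 0`, gives the
      -- bound.
      rcases lt_trichotomy c 0 with hc | rfl | hc
      · have h1 := hNadd (c • a₀) ((-c) • a₀)
        rw [← add_smul, add_neg_cancel, zero_smul, hNsmul (-c) (by linarith)] at h1
        linarith
      · simpa using hN0
      · rw [hNsmul c hc])
  refine ⟨f, fun a r h => (hfN a).trans (hle a r h), fun m hm => ?_⟩
  have := hf ⟨a₀, Submodule.mem_span_singleton_self a₀⟩
  rw [LinearPMap.mkSpanSingleton_apply] at this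
  change f a₀ = _ at this
  rw [this]
  exact hge _ _ hm

/-! ### States: Hahn–Banach, compactness and purity. -/

section States

set_option linter.unusedSectionVars false

variable {V : Type*} [NormedAddCommGroup V] [NormedSpace ℝ V]
  [PartialOrder V] [IsOrderedAddMonoid V] [PosSMulMono ℝ V] {u : V}

namespace IsOrderUnitSpace

theorem le_norm_smul (hV : IsOrderUnitSpace u) (v : V) : v ≤ ‖v‖ • u := by
  refine hV.le_of_forall_pos_le_add fun ε hε => ?_
  have h : sInf {l : ℝ | 0 ≤ l ∧ -(l • u) ≤ v ∧ v ≤ l • u} < ‖v‖ + ε := by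
    have := hV.norm_eq v
    rw [orderUnitNorm] at this
    linarith
  obtain ⟨l, ⟨_, -, hl⟩, hl1⟩ := exists_lt_of_csInf_lt (hV.orderUnit.2 v) h
  rw [← add_smul]
  exact hl.trans (real_smul_le_smul_right hl1.le hV.orderUnit.1)

theorem abs_apply_le (hV : IsOrderUnitSpace u) (f : V →ₗ[ℝ] ℝ) (hf : ∀ v, 0 ≤ v → 0 ≤ f v)
    (v : V) : |f v| ≤ f u * ‖v‖ := by
  have h1 := hf _ (sub_nonneg.2 (hV.le_norm_smul v))
  have h2 := hf _ (sub_nonneg.2 (hV.le_norm_smul (-v)))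
  rw [map_sub, map_smul, smul_eq_mul] at h1 h2
  rw [norm_neg, map_neg] at h2
  rw [abs_le]
  constructor <;> linarith

theorem exists_weakDual_eq (hV : IsOrderUnitSpace u) (f : V →ₗ[ℝ] ℝ)
    (hf : ∀ v, 0 ≤ v → 0 ≤ f v) : ∃ φ : WeakDual ℝ V, ∀ v, φ v = f v :=
  ⟨(f.mkContinuous (f u) (hV.abs_apply_le f hf) : V →L[ℝ] ℝ), fun _ => rfl⟩

theorem exists_state_eq (hV : IsOrderUnitSpace u) (f : V →ₗ[ℝ] ℝ)
    (hf : ∀ v, 0 ≤ v → 0 ≤ f v) (h1 : f u = 1) : ∃ φ ∈ stateSpace u, ∀ v, φ v = f v := by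
  obtain ⟨φ, hφ⟩ := hV.exists_weakDual_eq f hf
  exact ⟨φ, ⟨fun v hv => by rw [hφ]; exact hf v hv, by rw [hφ, h1]⟩, hφ⟩

/-- Hahn–Banach for the sublinear functional `M(·/u)`: its values at negative vectors force
positivity, and those at `u` and `-u` force normalisation. -/
theorem exists_state_apply_eq_gaugeM (hV : IsOrderUnitSpace u) {v : V} (hv : v ≠ 0) :
    ∃ φ ∈ stateSpace u, φ v = gaugeM v u := by
  have hu := hV.unit_ne_zero hv
  have hi := hV.unit_mem_interior
  obtain ⟨f, hf, hfv⟩ := exists_linearMap_le_of_rel (E := V) (fun a r => a ≤ r • u)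
    (fun a b r s h1 h2 => by rw [add_smul]; exact add_le_add h1 h2)
    (fun a r c hc h => by rw [mul_smul]; exact real_smul_le_smul_left hc.le h)
    (fun a => by obtain ⟨m, -, hm⟩ := hV.exists_le_smul hi a; exact ⟨m, hm⟩)
    (fun r hr => (hV.gaugeM_nonneg hu le_rfl hi).trans ((hV.gaugeM_le_iff hu 0 hi).2 hr)) hv
  have hpos : ∀ v, 0 ≤ v → 0 ≤ f v := fun v hv => by
    have := hf (-v) 0 (by rw [zero_smul]; exact neg_nonpos.2 hv)
    rw [map_neg] at this
    linarith
  have h1 : f u = 1 := by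
    have h2 := hf u 1 (by rw [one_smul])
    have h3 := hf (-u) (-1) (by rw [neg_smul, one_smul])
    rw [map_neg] at h3
    linarith
  obtain ⟨φ, hφ, hφf⟩ := hV.exists_state_eq f hpos h1
  refine ⟨φ, hφ, ?_⟩
  rw [hφf]
  refine le_antisymm (hf _ _ (hV.le_gaugeM_smul hu v hi)) (hfv _ fun r hr => ?_)
  exact (hV.gaugeM_le_iff hu v hi).2 hr

theorem le_of_forall_state_le (hV : IsOrderUnitSpace u) {v w : V}
    (h : ∀ φ ∈ stateSpace u, φ v ≤ φ w) : v ≤ w := by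
  by_cases hvw : v - w = 0
  · exact (sub_eq_zero.1 hvw).le
  obtain ⟨φ, hφ, hφv⟩ := hV.exists_state_apply_eq_gaugeM hvw
  have h1 := hV.le_gaugeM_smul (hV.unit_ne_zero hvw) (v - w) hV.unit_mem_interior
  have h2 := h φ hφ
  rw [map_sub] at hφv
  have h3 : gaugeM (v - w) u • u ≤ (0 : ℝ) • u :=
    real_smul_le_smul_right (by linarith) hV.orderUnit.1
  rw [zero_smul] at h3
  exact sub_nonpos.1 (h1.trans h3)

theorem state_mono {φ : WeakDual ℝ V} (hφ : φ ∈ stateSpace u) {v w : V} (h : v ≤ w) :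
    φ v ≤ φ w := by
  have := hφ.1 _ (sub_nonneg.2 h)
  rw [map_sub] at this
  linarith

theorem state_pos (hV : IsOrderUnitSpace u) {φ : WeakDual ℝ V} (hφ : φ ∈ stateSpace u) {x : V}
    (hx : x ∈ interior (posCone V)) : 0 < φ x := by
  obtain ⟨d, hd, hdx⟩ := hV.exists_smul_le hx
  have := state_mono hφ hdx
  rw [map_smul, hφ.2, smul_eq_mul, mul_one] at this
  linarith

theorem state_ext (hV : IsOrderUnitSpace u) {φ ψ : WeakDual ℝ V} (hφ : φ ∈ stateSpace u)
    (hψ : ψ ∈ stateSpace u) (h : ∀ x ∈ interior (posCone V), φ x = ψ x) : φ = ψ := by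
  refine DFunLike.ext _ _ fun v => ?_
  have h1 : v + (‖v‖ + 1) • u ∈ interior (posCone V) := by
    refine hV.mem_interior_of_smul_le one_pos ?_
    have := neg_le.1 (norm_neg v ▸ hV.le_norm_smul (-v))
    rw [add_smul, ← add_assoc]
    exact le_add_of_nonneg_left (neg_le_iff_add_nonneg.1 this)
  have h2 := h _ h1
  rw [map_add, map_add, map_smul, map_smul, hφ.2, hψ.2] at h2
  linarith

/-- Banach–Alaoglu: positivity and `φ u = 1` are closed conditions, and they bound the norm by 1. -/
theorem isCompact_stateSpace (hV : IsOrderUnitSpace u) : IsCompact (stateSpace u) := by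
  have hcl : IsClosed (stateSpace u) := by
    have : stateSpace u = (⋂ (v : V) (_ : 0 ≤ v), {φ : WeakDual ℝ V | 0 ≤ φ v}) ∩ {φ | φ u = 1} := by
      ext φ
      simp [stateSpace]
    rw [this]
    refine IsClosed.inter (isClosed_iInter fun v => isClosed_iInter fun _ => ?_) ?_
    · exact isClosed_le continuous_const (WeakDual.eval_continuous v)
    · exact isClosed_eq (WeakDual.eval_continuous u) continuous_const
  refine (WeakDual.isCompact_closedBall (𝕜 := ℝ) (E := V) 0 1).of_isClosed_subset hcl ?_
  intro φ hφ
  have h1 : ‖(WeakDual.toStrongDual φ)‖ ≤ 1 := by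
    refine ContinuousLinearMap.opNorm_le_bound _ zero_le_one fun v => ?_
    have := hV.abs_apply_le ((WeakDual.toStrongDual φ : V →L[ℝ] ℝ) : V →ₗ[ℝ] ℝ) hφ.1 v
    have h2 : ((WeakDual.toStrongDual φ : V →L[ℝ] ℝ) : V →ₗ[ℝ] ℝ) u = 1 := hφ.2
    rw [h2] at this
    exact this
  simpa using h1

/-- A positive functional dominated by a pure state is a multiple of it. -/
theorem eq_smul_of_le_pureState (hV : IsOrderUnitSpace u) {ψ : WeakDual ℝ V}
    (hψ : ψ ∈ pureStates u) (f : V →ₗ[ℝ] ℝ) (hf : ∀ v, 0 ≤ v → 0 ≤ f v)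
    (hle : ∀ v, 0 ≤ v → f v ≤ ψ v) (v : V) : f v = f u * ψ v := by
  have hc0 : 0 ≤ f u := hf u hV.orderUnit.1
  have hc1 : f u ≤ 1 := hψ.1.2 ▸ hle u hV.orderUnit.1
  rcases hc0.eq_or_lt with h0 | h0
  · have := hV.abs_apply_le f hf v
    rw [← h0, zero_mul] at this
    rw [← h0, zero_mul]
    exact abs_nonpos_iff.1 this
  let g : V →ₗ[ℝ] ℝ := (WeakDual.toStrongDual ψ : V →L[ℝ] ℝ) - f
  have hg : ∀ v, g v = ψ v - f v := fun v => rfl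
  have hgpos : ∀ v, 0 ≤ v → 0 ≤ g v := fun v hv => sub_nonneg.2 (hle v hv)
  have hgu : g u = 1 - f u := by rw [hg, hψ.1.2]
  rcases hc1.eq_or_lt with h1 | h1
  · have := hV.abs_apply_le g hgpos v
    rw [hgu, h1, sub_self, zero_mul] at this
    have := abs_nonpos_iff.1 this
    rw [hg] at this
    rw [h1]
    linarith
  have h1' : 0 < 1 - f u := sub_pos.2 h1
  -- Normalising `f` and `ψ - f` exhibits `ψ` as a proper convex combination of two states.
  obtain ⟨φ, hφ, hφf⟩ := hV.exists_state_eq ((f u)⁻¹ • f)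
    (fun v hv => mul_nonneg (inv_pos.2 h0).le (hf v hv)) (inv_mul_cancel₀ h0.ne')
  obtain ⟨χ, hχ, hχf⟩ := hV.exists_state_eq ((1 - f u)⁻¹ • g)
    (fun v hv => mul_nonneg (inv_pos.2 h1').le (hgpos v hv))
    (by rw [LinearMap.smul_apply, hgu, smul_eq_mul, inv_mul_cancel₀ h1'.ne'])
  have hseg : ψ ∈ openSegment ℝ φ χ := by
    refine ⟨f u, 1 - f u, h0, h1', by ring, ?_⟩
    refine DFunLike.ext _ _ fun w => ?_
    change f u * φ w + (1 - f u) * χ w = ψ w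
    rw [hφf, hχf, LinearMap.smul_apply, LinearMap.smul_apply, hg, smul_eq_mul, smul_eq_mul,
      mul_inv_cancel_left₀ h0.ne', mul_inv_cancel_left₀ h1'.ne']
    ring
  have heq : φ = ψ := hψ.2 hφ hχ hseg
  rw [← heq, hφf, LinearMap.smul_apply, smul_eq_mul, mul_inv_cancel_left₀ h0.ne']

/-- The sets `{z | ψ z < 1}` of a pure state `ψ` are upward directed. -/
theorem exists_ge_of_pureState (hV : IsOrderUnitSpace u) {ψ : WeakDual ℝ V}
    (hψ : ψ ∈ pureStates u) {z₁ z₂ : V} (h₁ : ψ z₁ < 1) (h₂ : ψ z₂ < 1) :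
    ∃ z, z₁ ≤ z ∧ z₂ ≤ z ∧ ψ z < 1 := by
  by_contra! hno
  by_cases hz : (z₁, z₂) = (0 : V × V)
  · obtain ⟨rfl, rfl⟩ := Prod.mk.inj hz
    have := hno 0 le_rfl le_rfl
    linarith
  have hmono : ∀ {v w : V}, v ≤ w → ψ v ≤ ψ w := state_mono hψ.1
  -- The functional is `inf {ψ z | z ≥ a.1, z ≥ a.2}` on `V × V`, at least 1 at `(z₁, z₂)` if
  -- directedness fails. A minorant `f` restricts to `ψ` on the diagonal, so its two positive
  -- components add up to `ψ`. By purity both are multiples of `ψ`, whence `f (z₁, z₂) < 1`.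
  obtain ⟨f, hf, hfz⟩ := exists_linearMap_le_of_rel (E := V × V)
    (fun a r => ∃ z, a.1 ≤ z ∧ a.2 ≤ z ∧ ψ z ≤ r)
    (by
      rintro a b r s ⟨z, h1, h2, h3⟩ ⟨z', h1', h2', h3'⟩
      exact ⟨z + z', add_le_add h1 h1', add_le_add h2 h2', by rw [map_add]; linarith⟩)
    (by
      rintro a r c hc ⟨z, h1, h2, h3⟩
      refine ⟨c • z, real_smul_le_smul_left hc.le h1, real_smul_le_smul_left hc.le h2, ?_⟩
      rw [map_smul, smul_eq_mul]
      exact mul_le_mul_of_nonneg_left h3 hc.le)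
    (fun a => by
      obtain ⟨m, hm, h1⟩ := hV.exists_le_smul hV.unit_mem_interior a.1
      obtain ⟨n, hn, h2⟩ := hV.exists_le_smul hV.unit_mem_interior a.2
      refine ⟨_, (m + n) • u, h1.trans ?_, h2.trans ?_, le_rfl⟩ <;>
      exact real_smul_le_smul_right (by linarith) hV.orderUnit.1)
    (by
      rintro r ⟨z, h1, -, h3⟩
      exact (hψ.1.1 z h1).trans h3) hz
  have hone : 1 ≤ f (z₁, z₂) := hfz 1 (by rintro r ⟨z, h1, h2, h3⟩; exact (hno z h1 h2).trans h3)
  have hdiag_le : ∀ v, f (v, v) ≤ ψ v := fun v => hf _ _ ⟨v, le_rfl, le_rfl, le_rfl⟩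
  have hdiag : ∀ v, f (v, v) = ψ v := fun v => by
    refine le_antisymm (hdiag_le v) ?_
    have := hdiag_le (-v)
    have h2 : ((-v, -v) : V × V) = -(v, v) := rfl
    rw [h2, map_neg, map_neg] at this
    linarith
  have hsplit : ∀ v w, f (v, w) = f (v, 0) + f (0, w) := fun v w => by
    rw [← map_add, Prod.mk_add_mk, add_zero, zero_add]
  have hp1 : ∀ v, 0 ≤ v → 0 ≤ f (v, 0) := fun v hv => by
    have := hf (-(v, 0)) 0 ⟨0, neg_nonpos.2 hv, by simp, by simp⟩
    rw [map_neg] at this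
    linarith
  have hp2 : ∀ v, 0 ≤ v → 0 ≤ f (0, v) := fun v hv => by
    have := hf (-(0, v)) 0 ⟨0, by simp, neg_nonpos.2 hv, by simp⟩
    rw [map_neg] at this
    linarith
  have e1 := hV.eq_smul_of_le_pureState hψ (f ∘ₗ LinearMap.inl ℝ V V) hp1
    (fun v hv => by
      have := hp2 v hv
      rw [← hdiag, hsplit]
      change f (v, 0) ≤ _
      linarith) z₁
  have e2 := hV.eq_smul_of_le_pureState hψ (f ∘ₗ LinearMap.inr ℝ V V) hp2
    (fun v hv => by
      have := hp1 v hv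
      rw [← hdiag, hsplit]
      change f (0, v) ≤ _
      linarith) z₂
  change f (z₁, 0) = f (u, 0) * _ at e1
  change f (0, z₂) = f (0, u) * _ at e2
  have e3 := hdiag u
  rw [hsplit, hψ.1.2] at e3
  rw [hsplit, e1, e2] at hone
  have k1 := hp1 u hV.orderUnit.1
  have k2 := hp2 u hV.orderUnit.1
  rcases k1.eq_or_lt with h | h
  · rw [← h] at e3 hone
    nlinarith
  · nlinarith

/-- The face `{φ | φ q = 1}` of the state space contains a pure state if `M(q/u) = 1`. -/
theorem exists_pureState_apply_eq_one (hV : IsOrderUnitSpace u) {q : V} (hq0 : q ≠ 0)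
    (hq : gaugeM q u = 1) : ∃ ψ ∈ pureStates u, ψ q = 1 := by
  have hqu : q ≤ u := by
    have := hV.le_gaugeM_smul (hV.unit_ne_zero hq0) q hV.unit_mem_interior
    rwa [hq, one_smul] at this
  have hne : (stateSpace u ∩ {φ | φ q = 1}).Nonempty := by
    obtain ⟨φ, hφ, h⟩ := hV.exists_state_apply_eq_gaugeM hq0
    exact ⟨φ, hφ, by rw [← hq]; exact h⟩
  have hcpt : IsCompact (stateSpace u ∩ {φ : WeakDual ℝ V | φ q = 1}) :=
    hV.isCompact_stateSpace.inter_right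
      (isClosed_eq (WeakDual.eval_continuous q) continuous_const)
  have : LocallyConvexSpace ℝ (WeakDual ℝ V) :=
    inferInstanceAs (LocallyConvexSpace ℝ (WeakBilin (topDualPairing ℝ V)))
  obtain ⟨ψ, hψ⟩ := hcpt.extremePoints_nonempty hne
  -- Since `q ≤ u`, the value 1 is maximal on states, so `{φ q = 1}` is a face and its extreme
  -- points are pure.
  refine ⟨ψ, ⟨hψ.1.1, fun φ hφ χ hχ hseg => ?_⟩, hψ.1.2⟩
  have hφ1 : φ q ≤ 1 := hφ.2 ▸ state_mono hφ hqu
  have hχ1 : χ q ≤ 1 := hχ.2 ▸ state_mono hχ hqu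
  obtain ⟨a, b, ha, hb, hab, h⟩ := id hseg
  have hs : a * φ q + b * χ q = 1 := by
    have h1 : ψ q = 1 := hψ.1.2
    rw [← h] at h1
    exact h1
  have hφq : φ q = 1 := by nlinarith
  have hχq : χ q = 1 := by nlinarith
  exact hψ.2 ⟨hφ, hφq⟩ ⟨hχ, hχq⟩ hseg

end IsOrderUnitSpace

end States

/-! ### Extreme vectors and comparability. -/

section ExtremeVectors

set_option linter.unusedSectionVars false

variable {V : Type*} [NormedAddCommGroup V] [NormedSpace ℝ V]
  [PartialOrder V] [IsOrderedAddMonoid V] [PosSMulMono ℝ V] {u : V}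

theorem IsExtremeVector.smul {r : V} (hr : IsExtremeVector r) {c : ℝ} (hc : 0 < c) :
    IsExtremeVector (c • r) := by
  refine ⟨smul_ne_zero hc.ne' hr.1, smul_nonneg hc.le hr.2.1, fun v hv hvr => ?_⟩
  have h1 : c⁻¹ • v ≤ r := by
    rw [real_smul_le_iff (inv_pos.2 hc), inv_inv]
    exact hvr
  obtain ⟨l, hl, h⟩ := hr.2.2 _ (smul_nonneg (inv_pos.2 hc).le hv) h1
  refine ⟨l, hl, ?_⟩
  rw [smul_comm, ← h, smul_smul, mul_inv_cancel₀ hc.ne', one_smul]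

theorem IsExtremeVector.exists_eq_smul_of_le {s r : V} (hs : IsExtremeVector s) (hr : 0 ≤ r)
    (hr0 : r ≠ 0) (h : r ≤ s) : ∃ l : ℝ, s = l • r := by
  obtain ⟨l, -, hl⟩ := hs.2.2 r hr h
  have hl0 : l ≠ 0 := by
    rintro rfl
    rw [zero_smul] at hl
    exact hr0 hl
  exact ⟨l⁻¹, by rw [hl, smul_smul, inv_mul_cancel₀ hl0, one_smul]⟩

/-- A positive vector is extreme if its multiples are comparable to everything below it. -/
theorem IsOrderUnitSpace.isExtremeVector_of_comparable (hV : IsOrderUnitSpace u) {r : V}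
    (hr0 : r ≠ 0) (hr : 0 ≤ r)
    (h : ∀ v, 0 ≤ v → v ≤ r → ∀ t : ℝ, 0 ≤ t → t ≤ 1 → v ≤ t • r ∨ t • r ≤ v) :
    IsExtremeVector r := by
  refine ⟨hr0, hr, fun v hv hvr => ?_⟩
  set T := {t : ℝ | 0 ≤ t ∧ v ≤ t • r} with hT
  have hbdd : BddBelow T := ⟨0, fun t ht => ht.1⟩
  have h1T : (1 : ℝ) ∈ T := ⟨zero_le_one, by rwa [one_smul]⟩
  have h0 : 0 ≤ sInf T := le_csInf ⟨1, h1T⟩ fun t ht => ht.1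
  have h1 : sInf T ≤ 1 := csInf_le hbdd h1T
  -- Slightly larger multiples of `r` dominate `v`; slightly smaller ones do not, so by
  -- comparability they lie below `v`.
  refine ⟨sInf T, h0, le_antisymm ?_ ?_⟩
  · refine hV.le_of_forall_pos_le_add_smul (x := r) fun ε hε => ?_
    obtain ⟨t, ht, ht'⟩ := exists_lt_of_csInf_lt ⟨1, h1T⟩ (lt_add_of_pos_right (sInf T) hε)
    rw [← add_smul]
    exact ht.2.trans (real_smul_le_smul_right ht'.le hr)
  · refine hV.le_of_forall_pos_le_add_smul (x := r) fun ε hε => ?_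
    rcases le_or_gt (sInf T - ε) 0 with hlt | hlt
    · refine (real_smul_le_smul_right (show sInf T ≤ ε by linarith) hr).trans ?_
      exact le_add_of_nonneg_left hv
    · have h2 : (sInf T - ε) • r ≤ v := by
        refine (h v hv hvr _ hlt.le (by linarith)).resolve_left fun h3 => ?_
        have := csInf_le hbdd (show sInf T - ε ∈ T from ⟨hlt.le, h3⟩)
        linarith
      rw [sub_smul] at h2
      exact sub_le_iff_le_add.1 h2

end ExtremeVectors

/-! ### Gauge-reversing maps and the bijection of atoms. -/

section GaugeReversing

set_option linter.unusedSectionVars false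

variable {V : Type*} [NormedAddCommGroup V] [NormedSpace ℝ V]
  [PartialOrder V] [IsOrderedAddMonoid V] [PosSMulMono ℝ V]
  {W : Type*} [NormedAddCommGroup W] [NormedSpace ℝ W]
  [PartialOrder W] [IsOrderedAddMonoid W] [PosSMulMono ℝ W]
  {u : V} {e : W} {Ψ : ConeInterior V ≃ ConeInterior W}

/-- An order unit space whose cone interior is a singleton is trivial. -/
theorem unit_ne_zero_of_equiv (hV : IsOrderUnitSpace u) (hW : IsOrderUnitSpace e)
    (Ψ : ConeInterior V ≃ ConeInterior W) (hu : u ≠ 0) : e ≠ 0 := by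
  intro he
  have hsub : ∀ v w : W, v = w := fun v w => by
    have h0 : ∀ v : W, v = 0 := fun v => by
      by_contra hv
      exact hW.unit_ne_zero hv he
    rw [h0 v, h0 w]
  have h2 : (2 : ℝ) • u ∈ interior (posCone V) := hV.smul_mem_interior hV.unit_mem_interior two_pos
  have h3 := Ψ.injective (Subtype.ext (hsub (Ψ ⟨_, h2⟩) (Ψ ⟨u, hV.unit_mem_interior⟩)))
  have h4 : (2 : ℝ) • u = u := congrArg Subtype.val h3
  rw [two_smul] at h4
  exact hu (add_eq_left.1 h4)

namespace IsGaugeReversing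

theorem symm (hΨ : IsGaugeReversing Ψ) : IsGaugeReversing Ψ.symm := fun v w => by
  rw [hΨ (Ψ.symm w) (Ψ.symm v), Equiv.apply_symm_apply, Equiv.apply_symm_apply]

theorem le_smul_iff (hΨ : IsGaugeReversing Ψ) (hV : IsOrderUnitSpace u) (hW : IsOrderUnitSpace e)
    (hu : u ≠ 0) (v w : ConeInterior V) (m : ℝ) :
    (v : V) ≤ m • (w : V) ↔ (Ψ w : W) ≤ m • (Ψ v : W) := by
  rw [← hV.gaugeM_le_iff hu _ w.2, hΨ,
    hW.gaugeM_le_iff (unit_ne_zero_of_equiv hV hW Ψ hu) _ (Ψ v).2]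

theorem le_iff (hΨ : IsGaugeReversing Ψ) (hV : IsOrderUnitSpace u) (hW : IsOrderUnitSpace e)
    (hu : u ≠ 0) (v w : ConeInterior V) : (v : V) ≤ w ↔ (Ψ w : W) ≤ Ψ v := by
  simpa using hΨ.le_smul_iff hV hW hu v w 1

theorem map_smul (hΨ : IsGaugeReversing Ψ) (hV : IsOrderUnitSpace u) (hW : IsOrderUnitSpace e)
    (hu : u ≠ 0) (v w : ConeInterior V) {c : ℝ} (hc : 0 < c) (h : (w : V) = c • (v : V)) :
    (Ψ w : W) = c⁻¹ • (Ψ v : W) := by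
  refine le_antisymm ?_ ?_
  · rw [← hΨ.le_smul_iff hV hW hu, h, smul_smul, inv_mul_cancel₀ hc.ne', one_smul]
  · rw [real_smul_le_iff (inv_pos.2 hc), inv_inv, ← hΨ.le_smul_iff hV hW hu, h]

/-- Everything between `Ψ b` and `Ψ a` comes from the segment `[a, b]`, which is a chain because `p`
is extreme; the comparability criterion then applies. -/
theorem isExtremeVector_sub (hΨ : IsGaugeReversing Ψ) (hV : IsOrderUnitSpace u)
    (hW : IsOrderUnitSpace e) {p : V} (hp : IsExtremeVector p) (a b : ConeInterior V) {t : ℝ}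
    (ht : 0 < t) (hab : (b : V) = a + t • p) : IsExtremeVector ((Ψ a : W) - Ψ b) := by
  have hu := hV.unit_ne_zero hp.1
  have hle : ∀ v w : ConeInterior V, (v : V) ≤ w ↔ (Ψ w : W) ≤ Ψ v := hΨ.le_iff hV hW hu
  have htp := hp.smul ht
  have hab' : (a : V) ≤ b := by rw [hab]; exact le_add_of_nonneg_right htp.2.1
  have hr : 0 ≤ (Ψ a : W) - Ψ b := sub_nonneg.2 ((hle _ _).1 hab')
  refine hW.isExtremeVector_of_comparable ?_ hr fun v hv hvr s hs hs1 => ?_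
  · intro h0
    have := congrArg Subtype.val (Ψ.injective (Subtype.ext (sub_eq_zero.1 h0)))
    rw [hab] at this
    exact htp.1 (left_eq_add.1 this)
  have key : ∀ w : W, 0 ≤ w → w ≤ (Ψ a : W) - Ψ b →
      ∃ c : ConeInterior V, (Ψ c : W) = Ψ b + w ∧ ∃ l : ℝ, (c : V) = a + l • p := by
    intro w hw hwr
    have hmem := hW.mem_interior_of_le (Ψ b).2 (le_add_of_nonneg_right (a := (Ψ b : W)) hw)
    refine ⟨Ψ.symm ⟨_, hmem⟩, by rw [Equiv.apply_symm_apply], ?_⟩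
    set c := Ψ.symm ⟨_, hmem⟩ with hc
    have hc' : (Ψ c : W) = Ψ b + w := by rw [hc, Equiv.apply_symm_apply]
    have h1 : (c : V) ≤ b := (hle _ _).2 (by rw [hc']; exact le_add_of_nonneg_right hw)
    have h2 : (a : V) ≤ c := (hle _ _).2 (by rw [hc']; exact le_sub_iff_add_le'.1 hwr)
    obtain ⟨l, -, hl⟩ := htp.2.2 ((c : V) - a) (sub_nonneg.2 h2)
      (sub_le_iff_le_add'.2 (by rwa [← hab]))
    exact ⟨l * t, by rw [mul_smul, ← hl, add_sub_cancel]⟩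
  obtain ⟨c, hc, l, hl⟩ := key v hv hvr
  obtain ⟨d, hd, k, hk⟩ := key (s • ((Ψ a : W) - Ψ b)) (smul_nonneg hs hr) (by
    have := real_smul_le_smul_right hs1 hr
    rwa [one_smul] at this)
  rcases le_total l k with h | h
  · right
    have h1 : (c : V) ≤ d := by
      rw [hl, hk]
      exact add_le_add_right (real_smul_le_smul_right h hp.2.1) _
    rw [hle, hc, hd] at h1
    exact (add_le_add_iff_left _).1 h1
  · left
    have h1 : (d : V) ≤ c := by
      rw [hl, hk]
      exact add_le_add_right (real_smul_le_smul_right h hp.2.1) _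
    rw [hle, hc, hd] at h1
    exact (add_le_add_iff_left _).1 h1

/-- The line through the unit in the direction of an atom is mapped into a line. -/
theorem exists_extreme_line (hΨ : IsGaugeReversing Ψ) (hV : IsOrderUnitSpace u)
    (hW : IsOrderUnitSpace e) (hΨu : Ψ ⟨u, hV.unit_mem_interior⟩ = ⟨e, hW.unit_mem_interior⟩)
    {p : V} (hp : p ∈ coneAtoms u) :
    ∃ r : W, IsExtremeVector r ∧ ∀ t : ℝ, -1 < t → ∀ h : u + t • p ∈ interior (posCone V),
      ∃ f : ℝ, (Ψ ⟨u + t • p, h⟩ : W) = e - f • r := by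
  have hu := hV.unit_ne_zero hp.1.1
  have hmem : ∀ t : ℝ, -1 < t → u + t • p ∈ interior (posCone V) := fun t ht =>
    hV.add_smul_mem_interior_of_gaugeM_eq_one hu hp.1.2.1 hp.2 ht
  have hmono : ∀ s t : ℝ, ∀ hs ht, s ≤ t →
      (Ψ ⟨u + t • p, ht⟩ : W) ≤ Ψ ⟨u + s • p, hs⟩ := fun s t hs ht h =>
    (hΨ.le_iff hV hW hu _ _).1 (add_le_add_right (real_smul_le_smul_right h hp.1.2.1) u)
  have hzero : ∀ h, (Ψ ⟨u + (0 : ℝ) • p, h⟩ : W) = e := fun h => by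
    have h1 : (⟨u + (0 : ℝ) • p, h⟩ : ConeInterior V) = ⟨u, hV.unit_mem_interior⟩ :=
      Subtype.ext (by simp)
    rw [h1, hΨu]
  have hext : ∀ s t : ℝ, ∀ hs ht, s < t →
      IsExtremeVector ((Ψ ⟨u + s • p, hs⟩ : W) - Ψ ⟨u + t • p, ht⟩) := fun s t hs ht h =>
    hΨ.isExtremeVector_sub hV hW hp.1 _ _ (sub_pos.2 h) (by
      change u + t • p = u + s • p + (t - s) • p
      rw [sub_smul]; abel)
  have h0 := hmem 0 (by norm_num)
  have h1 := hmem 1 (by norm_num)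
  have hr : IsExtremeVector (e - (Ψ ⟨u + (1 : ℝ) • p, h1⟩ : W)) := by
    have := hext 0 1 h0 h1 one_pos
    rwa [hzero] at this
  refine ⟨_, hr, fun t ht h => ?_⟩
  -- In each case one of two nested intervals has extreme length, which makes both lengths
  -- proportional. For `t < 0` and `t > 1` the interval with ends 0 and 1 is the smaller one; for
  -- `t` in `[0, 1]` it is the larger.
  rcases lt_or_ge t 0 with ht0 | ht0
  · have hle := hmono t 0 h h0 ht0.le
    rw [hzero] at hle
    obtain ⟨l, hl⟩ := (hext t 1 h h1 (by linarith)).exists_eq_smul_of_le hr.2.1 hr.1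
      (sub_le_sub_right hle _)
    refine ⟨1 - l, ?_⟩
    rw [sub_smul, one_smul, ← hl]
    abel
  rcases le_or_gt t 1 with ht1 | ht1
  · have hle := hmono 0 t h0 h ht0
    rw [hzero] at hle
    obtain ⟨l, -, hl⟩ := hr.2.2 (e - (Ψ ⟨u + t • p, h⟩ : W)) (sub_nonneg.2 hle)
      (sub_le_sub_left (hmono t 1 h h1 ht1) e)
    exact ⟨l, by rw [← hl, sub_sub_cancel]⟩
  · have hx := hext 0 t h0 h (by linarith)
    rw [hzero] at hx
    obtain ⟨l, hl⟩ := hx.exists_eq_smul_of_le hr.2.1 hr.1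
      (sub_le_sub_left (hmono 1 t h1 h ht1.le) e)
    exact ⟨l, by rw [← hl, sub_sub_cancel]⟩

/-- The atom `q` is the normalised direction of the image line; gauges against the units then
determine the coefficient `f`. -/
theorem exists_corresponds (hΨ : IsGaugeReversing Ψ) (hV : IsOrderUnitSpace u)
    (hW : IsOrderUnitSpace e) (hΨu : Ψ ⟨u, hV.unit_mem_interior⟩ = ⟨e, hW.unit_mem_interior⟩)
    {p : V} (hp : p ∈ coneAtoms u) : ∃ q ∈ coneAtoms e, Corresponds Ψ u e p q := by
  have hu := hV.unit_ne_zero hp.1.1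
  have he := unit_ne_zero_of_equiv hV hW Ψ hu
  obtain ⟨r, hr, hline⟩ := hΨ.exists_extreme_line hV hW hΨu hp
  have hm := hW.gaugeM_pos he hr.2.1 hr.1 hW.unit_mem_interior
  have hq : (gaugeM r e)⁻¹ • r ∈ coneAtoms e :=
    ⟨hr.smul (inv_pos.2 hm), by
      rw [hW.gaugeM_smul he _ hW.unit_mem_interior (inv_pos.2 hm), inv_mul_cancel₀ hm.ne']⟩
  refine ⟨_, hq, fun t ht => ?_⟩
  have hmem := hV.add_smul_mem_interior_of_gaugeM_eq_one hu hp.1.2.1 hp.2 ht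
  refine ⟨hmem, ?_⟩
  obtain ⟨f, hf⟩ : ∃ f : ℝ, (Ψ ⟨u + t • p, hmem⟩ : W) = e - f • (gaugeM r e)⁻¹ • r := by
    obtain ⟨f, hf⟩ := hline t ht hmem
    exact ⟨f * gaugeM r e, by
      rw [smul_smul, mul_assoc, mul_inv_cancel₀ hm.ne', mul_one, hf]⟩
  set q := (gaugeM r e)⁻¹ • r with hqdef
  -- This is `M((u + t p)/u) = M(e/(e - f q))` in coordinates; `hdown` is the same with the roles
  -- exchanged.
  have hup : ∀ m : ℝ, 1 ≤ m → (t ≤ m - 1 ↔ m * f ≤ m - 1) := by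
    intro m hm1
    rw [← hV.smul_le_smul_unit_iff hp.1.2.1 hu hp.2 (by linarith),
      ← hW.smul_le_smul_unit_iff hq.1.2.1 he hq.2 (by linarith)]
    have := hΨ.le_smul_iff hV hW hu ⟨u + t • p, hmem⟩ ⟨u, hV.unit_mem_interior⟩ m
    rw [hΨu, hf, smul_sub, smul_smul] at this
    change u + t • p ≤ m • u ↔ e ≤ m • e - (m * f) • q at this
    rw [sub_smul, sub_smul, one_smul, one_smul, le_sub_iff_add_le', this, le_sub_iff_add_le,
      le_sub_iff_add_le, add_comm]
  have hdown : ∀ m : ℝ, 1 ≤ m → (-(m * t) ≤ m - 1 ↔ -f ≤ m - 1) := by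
    intro m hm1
    rw [← hV.smul_le_smul_unit_iff hp.1.2.1 hu hp.2 (by linarith),
      ← hW.smul_le_smul_unit_iff hq.1.2.1 he hq.2 (by linarith)]
    have := hΨ.le_smul_iff hV hW hu ⟨u, hV.unit_mem_interior⟩ ⟨u + t • p, hmem⟩ m
    rw [hΨu, hf, smul_add, smul_smul] at this
    change u ≤ m • u + (m * t) • p ↔ e - f • q ≤ m • e at this
    rw [sub_smul, sub_smul, one_smul, one_smul, neg_smul, neg_smul, neg_le_sub_iff_le_add,
      neg_le_sub_iff_le_add, this, sub_le_iff_le_add]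
  suffices hft : f = t / (t + 1) by rw [hf, hft]
  have ht1 : 0 < t + 1 := by linarith
  rw [eq_div_iff ht1.ne']
  -- Each test value of `m` makes one side of an equivalence sharp: `1 / (t + 1)` and `1 - f` for `t
  -- < 0`, `1 + t` and `1 / (1 - f)` for `t > 0`. The `max` with 1 keeps `m` admissible.
  rcases lt_trichotomy t 0 with h0 | rfl | h0
  · have h1 : 1 ≤ 1 / (t + 1) := by rw [le_div_iff₀ ht1]; linarith
    have h2 := (hdown _ h1).1 (by field_simp; linarith)
    have h3 : (1 - f) * (t + 1) ≤ 1 := by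
      rw [← le_div_iff₀ ht1]; linarith
    have h4 := (hdown (max 1 (1 - f)) (le_max_left _ _)).2 (by
      have := le_max_right 1 (1 - f); linarith)
    rcases max_choice 1 (1 - f) with h5 | h5 <;> rw [h5] at h4 <;> nlinarith
  · have h1 := (hup 1 le_rfl).1 (by norm_num)
    have h2 := (hdown 1 le_rfl).1 (by norm_num)
    linarith
  · have h1 := (hup (1 + t) (by linarith)).1 (by linarith)
    have h2 : 0 < 1 - f := by
      by_contra! h
      nlinarith
    have h4 := (hup (max 1 (1 / (1 - f))) (le_max_left _ _)).2 (by
      have : 1 ≤ max 1 (1 / (1 - f)) * (1 - f) := by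
        rw [← div_le_iff₀ h2]; exact le_max_right _ _
      linarith)
    rcases max_choice 1 (1 / (1 - f)) with h5 | h5 <;> rw [h5] at h4
    · linarith
    · have h6 : 1 + t ≤ 1 / (1 - f) := by linarith
      rw [le_div_iff₀ h2] at h6
      nlinarith

end IsGaugeReversing

theorem Corresponds.eq {p : V} {q q' : W} (h : Corresponds Ψ u e p q)
    (h' : Corresponds Ψ u e p q') : q = q' := by
  obtain ⟨_, h1⟩ := h 1 (by norm_num)
  obtain ⟨_, h2⟩ := h' 1 (by norm_num)
  have h3 := sub_right_injective (h1.symm.trans h2)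
  exact smul_right_injective W (by norm_num : (1 : ℝ) / (1 + 1) ≠ 0) h3

/-- The substitution `t ↦ -t / (t + 1)` is an involution of `(-1, ∞)`. -/
theorem Corresponds.symm {p : V} {q : W} (h : Corresponds Ψ u e p q) :
    Corresponds Ψ.symm e u q p := by
  intro t ht
  have ht1 : 0 < t + 1 := by linarith
  obtain ⟨h1, h2⟩ := h (-(t / (t + 1))) (by rw [neg_lt_neg_iff, div_lt_one ht1]; linarith)
  have h3 : -(t / (t + 1)) / (-(t / (t + 1)) + 1) = -t := by
    have : -(t / (t + 1)) + 1 = 1 / (t + 1) := by field_simp; ring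
    rw [this]; field_simp
  rw [h3, neg_smul t q, sub_neg_eq_add] at h2
  have hmem : e + t • q ∈ interior (posCone W) := h2 ▸ (Ψ _).2
  refine ⟨hmem, ?_⟩
  have h4 : Ψ.symm ⟨e + t • q, hmem⟩ = ⟨u + (-(t / (t + 1))) • p, h1⟩ := by
    rw [Equiv.symm_apply_eq]
    exact Subtype.ext h2.symm
  rw [h4]
  change u + (-(t / (t + 1))) • p = _
  rw [neg_smul, sub_eq_add_neg]

/-- The bijection between the atoms of the two cones. -/
noncomputable def atomEquiv (hΨ : IsGaugeReversing Ψ) (hV : IsOrderUnitSpace u)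
    (hW : IsOrderUnitSpace e)
    (hΨu : Ψ ⟨u, hV.unit_mem_interior⟩ = ⟨e, hW.unit_mem_interior⟩) :
    coneAtoms u ≃ coneAtoms e :=
  have hΨe : Ψ.symm ⟨e, hW.unit_mem_interior⟩ = ⟨u, hV.unit_mem_interior⟩ := by
    rw [Equiv.symm_apply_eq, hΨu]
  have hf : ∀ p : coneAtoms u, ∃ q : coneAtoms e, Corresponds Ψ u e (p : V) (q : W) := fun p =>
    let ⟨q, hq, h⟩ := hΨ.exists_corresponds hV hW hΨu p.2
    ⟨⟨q, hq⟩, h⟩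
  have hg : ∀ q : coneAtoms e, ∃ p : coneAtoms u, Corresponds Ψ.symm e u (q : W) (p : V) :=
    fun q =>
    let ⟨p, hp, h⟩ := hΨ.symm.exists_corresponds hW hV hΨe q.2
    ⟨⟨p, hp⟩, h⟩
  { toFun := fun p => (hf p).choose
    invFun := fun q => (hg q).choose
    left_inv := fun p => Subtype.ext ((hg _).choose_spec.eq (hf p).choose_spec.symm)
    right_inv := fun q => Subtype.ext ((hf _).choose_spec.eq (hg q).choose_spec.symm) }

theorem corresponds_atomEquiv (hΨ : IsGaugeReversing Ψ) (hV : IsOrderUnitSpace u)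
    (hW : IsOrderUnitSpace e)
    (hΨu : Ψ ⟨u, hV.unit_mem_interior⟩ = ⟨e, hW.unit_mem_interior⟩) (p : coneAtoms u) :
    Corresponds Ψ u e (p : V) (atomEquiv hΨ hV hW hΨu p : W) := by
  have hf : ∃ q : coneAtoms e, Corresponds Ψ u e (p : V) (q : W) :=
    let ⟨q, hq, h⟩ := hΨ.exists_corresponds hV hW hΨu p.2
    ⟨⟨q, hq⟩, h⟩
  exact hf.choose_spec

end GaugeReversing

/-! ### Directed infima and Dini's argument. -/

section DirectedInfimum

set_option linter.unusedSectionVars false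

variable {V : Type*} [NormedAddCommGroup V] [NormedSpace ℝ V]
  [PartialOrder V] [IsOrderedAddMonoid V] [PosSMulMono ℝ V] {u : V}

/-- If `C = C_sc`, then downward directed subsets of `C` have pointwise infima in `C`. -/
theorem ConeEqConeSc.exists_isGLB (hsc : ConeEqConeSc u) (hV : IsOrderUnitSpace u)
    {D : Set V} (hne : D.Nonempty) (hpos : ∀ w ∈ D, 0 ≤ w) (hdir : ∀ v ∈ D, ∀ w ∈ D, ∃ z ∈ D, z ≤ v ∧ z ≤ w) :
    ∃ p : V, 0 ≤ p ∧ ∀ φ ∈ stateSpace u, IsGLB (φ '' D) (φ p) := by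
  set g : stateSpace u → ℝ := fun φ => sInf ((φ : WeakDual ℝ V) '' D) with hg
  have hneφ : ∀ φ : WeakDual ℝ V, (φ '' D).Nonempty := fun φ => hne.image φ
  have hbdd : ∀ φ : stateSpace u, BddBelow ((φ : WeakDual ℝ V) '' D) := fun φ =>
    ⟨0, by rintro _ ⟨w, hw, rfl⟩; exact φ.2.1 w (hpos w hw)⟩
  have hglb : ∀ φ : stateSpace u, IsGLB ((φ : WeakDual ℝ V) '' D) (g φ) := fun φ =>
    isGLB_csInf (hneφ φ) (hbdd φ)
  have hle : ∀ (φ : stateSpace u), ∀ w ∈ D, g φ ≤ (φ : WeakDual ℝ V) w := fun φ w hw =>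
    (hglb φ).1 ⟨w, hw, rfl⟩
  have hg0 : ∀ φ, 0 ≤ g φ := fun φ => (hglb φ).2 (by
    rintro _ ⟨w, hw, rfl⟩; exact φ.2.1 w (hpos w hw))
  have hlt : ∀ (φ : stateSpace u) (y : ℝ), g φ < y → ∃ w ∈ D, (φ : WeakDual ℝ V) w < y := by
    intro φ y hy
    obtain ⟨_, ⟨w, hw, rfl⟩, h⟩ := exists_lt_of_csInf_lt (hneφ φ) hy
    exact ⟨w, hw, h⟩
  have haff : IsAffineOnStates u g := by
    intro φ ψ χ t ht0 ht1 hχ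
    have hχ' : ∀ w, (χ : WeakDual ℝ V) w
        = t * (φ : WeakDual ℝ V) w + (1 - t) * (ψ : WeakDual ℝ V) w := fun w => by
      rw [hχ]; rfl
    have ht1' : 0 ≤ 1 - t := sub_nonneg.2 ht1
    refine le_antisymm (le_of_forall_pos_le_add fun ε hε => ?_) ((hglb χ).2 ?_)
    · obtain ⟨v, hv, hv'⟩ := hlt φ (g φ + ε) (by linarith)
      obtain ⟨w, hw, hw'⟩ := hlt ψ (g ψ + ε) (by linarith)
      -- An infimum of affine functions is only concave in general; a common lower bound in `D`
      -- gives the reverse inequality.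
      obtain ⟨z, hz, hzv, hzw⟩ := hdir v hv w hw
      have h1 := hle χ z hz
      rw [hχ'] at h1
      have h2 := (IsOrderUnitSpace.state_mono φ.2 hzv).trans hv'.le
      have h3 := (IsOrderUnitSpace.state_mono ψ.2 hzw).trans hw'.le
      nlinarith [mul_le_mul_of_nonneg_left h2 ht0, mul_le_mul_of_nonneg_left h3 ht1']
    · rintro _ ⟨w, hw, rfl⟩
      rw [hχ']
      exact add_le_add (mul_le_mul_of_nonneg_left (hle φ w hw) ht0)
        (mul_le_mul_of_nonneg_left (hle ψ w hw) ht1')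
  have husc : UpperSemicontinuous g := by
    intro φ y hy
    obtain ⟨w, hw, h⟩ := hlt φ y hy
    have hcont : Continuous fun χ : stateSpace u => (χ : WeakDual ℝ V) w :=
      (WeakDual.eval_continuous w).comp continuous_subtype_val
    filter_upwards [hcont.continuousAt.eventually_lt continuousAt_const h] with χ hχ
    exact (hle χ w hw).trans_lt hχ
  have hgmem : g ∈ affineUscPos u := by
    obtain ⟨w, hw⟩ := hne
    refine ⟨haff, husc, ⟨‖w‖, fun φ => ?_⟩, hg0⟩
    rw [abs_of_nonneg (hg0 φ)]
    have := IsOrderUnitSpace.state_mono φ.2 (hV.le_norm_smul w)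
    rw [map_smul, φ.2.2, smul_eq_mul, mul_one] at this
    exact (hle φ w hw).trans this
  have h0mem : (0 : stateSpace u → ℝ) ∈ affineUscPos u :=
    ⟨fun _ _ _ _ _ _ _ => by simp, upperSemicontinuous_const, ⟨0, fun _ => by simp⟩,
      fun _ => le_rfl⟩
  have hmem : g ∈ coneSc u := ⟨hg0, g, hgmem, 0, h0mem, (sub_zero g).symm⟩
  rw [← show stateEval u '' posCone V = coneSc u from hsc] at hmem
  obtain ⟨p, hp, hpg⟩ := hmem
  refine ⟨p, hp, fun φ hφ => ?_⟩
  have h1 : φ p = g ⟨φ, hφ⟩ := congrFun hpg ⟨φ, hφ⟩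
  rw [h1]
  exact hglb ⟨φ, hφ⟩

/-- Dini's argument: a directed set with pointwise infimum strictly below `v` contains an
element below `v`. -/
theorem IsOrderUnitSpace.exists_le_of_isGLB (hV : IsOrderUnitSpace u) {D : Set V}
    (hne : D.Nonempty) (hdir : ∀ v ∈ D, ∀ w ∈ D, ∃ z ∈ D, z ≤ v ∧ z ≤ w) {p v : V}
    (hp : ∀ φ ∈ stateSpace u, IsGLB (φ '' D) (φ p)) (hpv : ∀ φ ∈ stateSpace u, φ p < φ v) :
    ∃ w ∈ D, w ≤ v := by
  have : Nonempty D := hne.to_subtype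
  have : CompactSpace (stateSpace u) := isCompact_iff_compactSpace.1 hV.isCompact_stateSpace
  have hcont : ∀ w : V, Continuous fun χ : stateSpace u => (χ : WeakDual ℝ V) w := fun w =>
    (WeakDual.eval_continuous w).comp continuous_subtype_val
  obtain ⟨w, hw⟩ := isCompact_univ.elim_directed_cover
    (fun w : D => {χ : stateSpace u | (χ : WeakDual ℝ V) w < (χ : WeakDual ℝ V) v})
    (fun w => isOpen_lt (hcont w) (hcont v))
    (fun χ _ => by
      obtain ⟨_, ⟨w, hw, rfl⟩, h⟩ := (isGLB_lt_iff (hp χ χ.2)).1 (hpv χ χ.2)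
      exact Set.mem_iUnion.2 ⟨⟨w, hw⟩, h⟩)
    (fun a b => by
      obtain ⟨z, hz, hza, hzb⟩ := hdir a a.2 b b.2
      exact ⟨⟨z, hz⟩, fun χ hχ => (state_mono χ.2 hza).trans_lt hχ,
        fun χ hχ => (state_mono χ.2 hzb).trans_lt hχ⟩)
  exact ⟨w, w.2, hV.le_of_forall_state_le fun φ hφ => (hw (Set.mem_univ ⟨φ, hφ⟩)).le⟩

end DirectedInfimum

/-! ### From pure states to atoms and back. -/

section PureStates

set_option linter.unusedSectionVars false

variable {V : Type*} [NormedAddCommGroup V] [NormedSpace ℝ V]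
  [PartialOrder V] [IsOrderedAddMonoid V] [PosSMulMono ℝ V]
  {W : Type*} [NormedAddCommGroup W] [NormedSpace ℝ W]
  [PartialOrder W] [IsOrderedAddMonoid W] [PosSMulMono ℝ W]
  {u : V} {e : W} {Ψ : ConeInterior V ≃ ConeInterior W}

theorem unit_ne_zero_of_state (hV : IsOrderUnitSpace u) (hW : IsOrderUnitSpace e)
    (Ψ : ConeInterior V ≃ ConeInterior W) {ψ : WeakDual ℝ W} (hψ : ψ ∈ stateSpace e) : u ≠ 0 := by
  refine unit_ne_zero_of_equiv hW hV Ψ.symm ?_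
  rintro rfl
  have := hψ.2
  rw [map_zero] at this
  exact zero_ne_one this

namespace IsGaugeReversing

/-- Every pure state of `W` is the image of a vector of `C`. -/
theorem exists_gaugeM_eq_pureState (hΨ : IsGaugeReversing Ψ) (hV : IsOrderUnitSpace u)
    (hW : IsOrderUnitSpace e) (hΨu : Ψ ⟨u, hV.unit_mem_interior⟩ = ⟨e, hW.unit_mem_interior⟩)
    (hsc : ConeEqConeSc u) {ψ : WeakDual ℝ W} (hψ : ψ ∈ pureStates e) :
    ∃ p : V, 0 ≤ p ∧ ∀ x : ConeInterior V, gaugeM p (x : V) = ψ (Ψ x : W) := by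
  have hu := unit_ne_zero_of_state hV hW Ψ hψ.1
  set D : Set V := {w | ∃ h : w ∈ interior (posCone V), ψ (Ψ ⟨w, h⟩ : W) < 1} with hD
  have hsmul : ∀ (x : ConeInterior V) (c : ℝ), ψ (Ψ x : W) < c → c • (x : V) ∈ D := by
    intro x c hc
    have hψx := hW.state_pos hψ.1 (Ψ x).2
    have hc0 : 0 < c := hψx.trans hc
    refine ⟨hV.smul_mem_interior x.2 hc0, ?_⟩
    rw [hΨ.map_smul hV hW hu x _ hc0 rfl, _root_.map_smul, smul_eq_mul, inv_mul_eq_div,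
      div_lt_one hc0]
    exact hc
  have hne : D.Nonempty := ⟨_, hsmul ⟨u, hV.unit_mem_interior⟩ 2 (by
    rw [hΨu, hψ.1.2]; norm_num)⟩
  have hdir : ∀ v ∈ D, ∀ w ∈ D, ∃ z ∈ D, z ≤ v ∧ z ≤ w := by
    rintro v ⟨hv, hv1⟩ w ⟨hw, hw1⟩
    obtain ⟨z, hvz, hwz, hz⟩ := hW.exists_ge_of_pureState hψ hv1 hw1
    have hmem := hW.mem_interior_of_le (Ψ ⟨v, hv⟩).2 hvz
    refine ⟨Ψ.symm ⟨z, hmem⟩, ⟨(Ψ.symm ⟨z, hmem⟩).2, ?_⟩, ?_, ?_⟩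
    · change ψ (Ψ (Ψ.symm ⟨z, hmem⟩) : W) < 1
      rwa [Equiv.apply_symm_apply]
    · refine (hΨ.le_iff hV hW hu _ ⟨v, hv⟩).2 ?_
      rwa [Equiv.apply_symm_apply]
    · refine (hΨ.le_iff hV hW hu _ ⟨w, hw⟩).2 ?_
      rwa [Equiv.apply_symm_apply]
  obtain ⟨p, hp, hglb⟩ := hsc.exists_isGLB hV hne (fun w hw => interior_subset hw.1) hdir
  refine ⟨p, hp, fun x => le_antisymm ?_ ?_⟩
  -- For `c > ψ (Ψ x)` the multiple `c x` belongs to `D`, so `p ≤ c x`.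
  · refine le_of_forall_gt_imp_ge_of_dense fun c hc => ?_
    rw [hV.gaugeM_le_iff hu _ x.2]
    exact hV.le_of_forall_state_le fun φ hφ => (hglb φ hφ).1 ⟨_, hsmul x c hc, rfl⟩
  -- For `m > M(p/x)`, `m x` exceeds `p` strictly on every state, so it dominates some `w` in `D`;
  -- hence `Ψ x ≤ m Ψ w`.
  · refine le_of_forall_gt_imp_ge_of_dense fun m hm => ?_
    have hm0 : 0 ≤ m := (hV.gaugeM_nonneg hu hp x.2).trans hm.le
    obtain ⟨w, ⟨hw, hw1⟩, hwx⟩ := hV.exists_le_of_isGLB (v := m • (x : V)) hne hdir hglb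
      fun φ hφ => by
        have h1 := IsOrderUnitSpace.state_mono hφ (hV.le_gaugeM_smul hu p x.2)
        have h2 := hV.state_pos hφ x.2
        rw [_root_.map_smul, smul_eq_mul] at h1 ⊢
        nlinarith
    have h1 := IsOrderUnitSpace.state_mono hψ.1 ((hΨ.le_smul_iff hV hW hu ⟨w, hw⟩ x m).1 hwx)
    rw [_root_.map_smul, smul_eq_mul] at h1
    exact h1.trans (mul_le_of_le_one_right hm0 hw1.le)

/-- A vector below `p` dominates a multiple of `p` if `M(p/·)` is given by a pure state. -/
theorem gaugeM_smul_le_of_le (hΨ : IsGaugeReversing Ψ) (hV : IsOrderUnitSpace u)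
    (hW : IsOrderUnitSpace e) (hΨu : Ψ ⟨u, hV.unit_mem_interior⟩ = ⟨e, hW.unit_mem_interior⟩)
    {ψ : WeakDual ℝ W} (hψ : ψ ∈ pureStates e) {p : V}
    (hpψ : ∀ x : ConeInterior V, gaugeM p (x : V) = ψ (Ψ x : W)) {v : V} (hv : 0 ≤ v)
    (hvp : v ≤ p) : gaugeM v u • p ≤ v := by
  have hu := unit_ne_zero_of_state hV hW Ψ hψ.1
  have he := unit_ne_zero_of_equiv hV hW Ψ hu
  have hp : 0 ≤ p := hv.trans hvp
  have hsymm : ∀ (y : ConeInterior W) (c : ℝ), 0 < c →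
      ∀ h : c • (y : W) ∈ interior (posCone W),
      (Ψ.symm ⟨c • (y : W), h⟩ : V) = c⁻¹ • (Ψ.symm y : V) := fun y c hc h =>
    hΨ.symm.map_smul hW hV he y ⟨_, h⟩ hc rfl
  -- For interior `v` this is subadditivity of `M(·/Ψ v)`. A general `v` is replaced by `v + ε u`,
  -- at a cost of at most `ε k` in each of the two terms.
  have hadd : ∀ y z : ConeInterior W, ∀ h : (y : W) + z ∈ interior (posCone W),
      gaugeM v (Ψ.symm ⟨(y : W) + z, h⟩ : V)
        ≤ gaugeM v (Ψ.symm y : V) + gaugeM v (Ψ.symm z : V) := by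
    intro y z h
    obtain ⟨k, hk0, hk⟩ : ∃ k : ℝ, 0 < k ∧ ∀ ε : ℝ, 0 < ε → ∀ a : ConeInterior W,
        (a = y ∨ a = z) → gaugeM (v + ε • u) (Ψ.symm a : V) ≤ gaugeM v (Ψ.symm a : V) + ε * k := by
      refine ⟨max 1 (max (gaugeM u (Ψ.symm y : V)) (gaugeM u (Ψ.symm z : V))),
        one_pos.trans_le (le_max_left _ _), fun ε hε a ha => ?_⟩
      refine (hV.gaugeM_add_le hu _ _ (Ψ.symm a).2).trans (add_le_add_right ?_ _)
      rw [hV.gaugeM_smul hu _ (Ψ.symm a).2 hε]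
      refine mul_le_mul_of_nonneg_left ?_ hε.le
      rcases ha with rfl | rfl <;> simp
    refine le_of_forall_pos_le_add fun δ hδ => ?_
    have hε : 0 < δ / (2 * k) := by positivity
    have hmem := hV.add_smul_mem_interior hv hε
    have hrev : ∀ a : ConeInterior W, gaugeM (v + (δ / (2 * k)) • u) (Ψ.symm a : V)
        = gaugeM (a : W) (Ψ ⟨_, hmem⟩ : W) := fun a => by
      have := hΨ ⟨_, hmem⟩ (Ψ.symm a)
      rwa [Equiv.apply_symm_apply] at this
    have h1 := hk _ hε y (Or.inl rfl)
    have h2 := hk _ hε z (Or.inr rfl)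
    have h3 : gaugeM v (Ψ.symm ⟨(y : W) + z, h⟩ : V)
        ≤ gaugeM (v + (δ / (2 * k)) • u) (Ψ.symm ⟨(y : W) + z, h⟩ : V) :=
      hV.gaugeM_mono hu (Ψ.symm _).2
        (le_add_of_nonneg_right (smul_nonneg hε.le hV.orderUnit.1))
    rw [hrev] at h1 h2 h3
    have h4 := hW.gaugeM_add_le he (y : W) (z : W) (Ψ ⟨_, hmem⟩).2
    have h5 : δ / (2 * k) * k = δ / 2 := by field_simp
    change _ ≤ gaugeM ((y : W) + z) _ at h3
    linarith
  -- Taking the infimum over `z ≥ a` extends `M(v/Ψ⁻¹ ·)` from `K°` to a monotone sublinear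
  -- functional on `W`.
  obtain ⟨f, hf, hfe⟩ := exists_linearMap_le_of_rel (E := W)
    (fun a r => ∃ z : ConeInterior W, a ≤ z ∧ gaugeM v (Ψ.symm z : V) ≤ r)
    (by
      rintro a b r s ⟨y, hy, hr⟩ ⟨z, hz, hs⟩
      have hmem := hW.mem_interior_of_le y.2 (le_add_of_nonneg_right
        (IsOrderUnitSpace.nonneg_of_mem_interior z.2))
      exact ⟨⟨_, hmem⟩, add_le_add hy hz, (hadd y z hmem).trans (add_le_add hr hs)⟩)
    (by
      rintro a r c hc ⟨z, hz, hr⟩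
      have hmem := hW.smul_mem_interior z.2 hc
      refine ⟨⟨_, hmem⟩, real_smul_le_smul_left hc.le hz, ?_⟩
      rw [hsymm z c hc hmem, hV.gaugeM_le_iff hu _ (hV.smul_mem_interior (Ψ.symm z).2
        (inv_pos.2 hc)), smul_smul, mul_comm, inv_mul_cancel_left₀ hc.ne',
        ← hV.gaugeM_le_iff hu _ (Ψ.symm z).2]
      exact hr)
    (fun a => by
      obtain ⟨m, hm, h⟩ := hW.exists_le_smul hW.unit_mem_interior a
      exact ⟨_, ⟨_, hW.smul_mem_interior hW.unit_mem_interior hm⟩, h, le_rfl⟩)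
    (by
      rintro r ⟨z, -, hr⟩
      exact (hV.gaugeM_nonneg hu hv (Ψ.symm z).2).trans hr) he
  have hΨe : Ψ.symm ⟨e, hW.unit_mem_interior⟩ = ⟨u, hV.unit_mem_interior⟩ := by
    rw [Equiv.symm_apply_eq, hΨu]
  have hfle : ∀ z : ConeInterior W, f z ≤ gaugeM v (Ψ.symm z : V) := fun z =>
    hf _ _ ⟨z, le_rfl, le_rfl⟩
  have hfe' : f e = gaugeM v u := by
    refine le_antisymm ?_ (hfe _ ?_)
    · have := hfle ⟨e, hW.unit_mem_interior⟩
      rwa [hΨe] at this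
    · rintro r ⟨z, hz, hr⟩
      refine le_trans ?_ hr
      have h1 : (Ψ.symm z : V) ≤ u := by
        have := (hΨ.symm.le_iff hW hV he ⟨e, hW.unit_mem_interior⟩ z).1 hz
        rwa [hΨe] at this
      rw [hV.gaugeM_le_iff hu _ hV.unit_mem_interior]
      exact (hV.le_gaugeM_smul hu v (Ψ.symm z).2).trans
        (real_smul_le_smul_left (hV.gaugeM_nonneg hu hv (Ψ.symm z).2) h1)
  have hfψ : ∀ z : ConeInterior W, f z ≤ ψ (z : W) := fun z => by
    refine (hfle z).trans ((hV.gaugeM_mono hu (Ψ.symm z).2 hvp).trans ?_)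
    rw [hpψ, Equiv.apply_symm_apply]
  have hf0 : ∀ w : W, 0 ≤ w → 0 ≤ f w := by
    intro w hw
    have h1 : ∀ ε : ℝ, 0 < ε → f (-w) ≤ 0 + ε * gaugeM v u := fun ε hε => by
      have hmem := hW.smul_mem_interior hW.unit_mem_interior hε
      rw [zero_add]
      refine hf _ _ ⟨⟨_, hmem⟩, (neg_nonpos.2 hw).trans (smul_nonneg hε.le hW.orderUnit.1), ?_⟩
      rw [hsymm ⟨e, hW.unit_mem_interior⟩ ε hε hmem, hΨe, hV.gaugeM_le_iff hu _
        (hV.smul_mem_interior hV.unit_mem_interior (inv_pos.2 hε)), smul_smul, mul_comm,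
        inv_mul_cancel_left₀ hε.ne']
      exact hV.le_gaugeM_smul hu v hV.unit_mem_interior
    have h2 : f (-w) ≤ 0 := by
      refine le_of_forall_pos_le_add fun δ hδ => ?_
      have hg := hV.gaugeM_nonneg hu hv hV.unit_mem_interior
      have h3 := h1 (δ / (gaugeM v u + 1)) (by positivity)
      have h4 : δ / (gaugeM v u + 1) * gaugeM v u ≤ δ := by
        rw [div_mul_eq_mul_div, div_le_iff₀ (by linarith)]
        nlinarith
      linarith
    rw [map_neg] at h2
    linarith
  have hfψ' : ∀ w : W, 0 ≤ w → f w ≤ ψ w := by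
    intro w hw
    refine le_of_forall_pos_le_add fun δ hδ => ?_
    have h1 := hfψ ⟨_, hW.add_smul_mem_interior hw hδ⟩
    change f (w + δ • e) ≤ ψ (w + δ • e) at h1
    rw [map_add, map_add, _root_.map_smul, _root_.map_smul, hψ.1.2, smul_eq_mul, smul_eq_mul,
      mul_one] at h1
    have := mul_nonneg hδ.le (hf0 e hW.orderUnit.1)
    linarith
  -- Purity gives `f = M(v/u) ψ`, so `M(v/u) M(p/x) ≤ M(v/x)` for every interior `x`.
  have hc := hW.eq_smul_of_le_pureState hψ f hf0 hfψ'
  refine hV.le_of_gaugeM_le hu hv fun x hx => ?_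
  refine (hV.gaugeM_smul_le hu p hx (hV.gaugeM_nonneg hu hv hV.unit_mem_interior)).trans ?_
  have h1 := hfle (Ψ ⟨x, hx⟩)
  rw [hc, Equiv.symm_apply_apply, hfe', ← hpψ] at h1
  exact h1

/-- Subtract from `v` the largest multiple of `p` below it. A nonzero remainder would still lie
below `p`, hence dominate a further positive multiple of `p`. -/
theorem mem_coneAtoms_of_pureState (hΨ : IsGaugeReversing Ψ) (hV : IsOrderUnitSpace u)
    (hW : IsOrderUnitSpace e) (hΨu : Ψ ⟨u, hV.unit_mem_interior⟩ = ⟨e, hW.unit_mem_interior⟩)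
    {ψ : WeakDual ℝ W} (hψ : ψ ∈ pureStates e) {p : V} (hp : 0 ≤ p)
    (hpψ : ∀ x : ConeInterior V, gaugeM p (x : V) = ψ (Ψ x : W)) : p ∈ coneAtoms u := by
  have hu := unit_ne_zero_of_state hV hW Ψ hψ.1
  have hp1 : gaugeM p u = 1 := by
    rw [hpψ ⟨u, hV.unit_mem_interior⟩, hΨu, hψ.1.2]
  have hp0 : p ≠ 0 := by
    rintro rfl
    have := (hV.gaugeM_le_iff hu 0 hV.unit_mem_interior (m := 0)).2 (by simp)
    linarith
  refine ⟨⟨hp0, hp, fun v hv hvp => ?_⟩, hp1⟩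
  set T := {c : ℝ | c • p ≤ v} with hT
  have hbdd : BddAbove T := by
    refine ⟨gaugeM v u, fun c hc => ?_⟩
    have h1 : c • p ≤ gaugeM v u • u :=
      le_trans (show c • p ≤ v from hc) (hV.le_gaugeM_smul hu v hV.unit_mem_interior)
    exact (hV.smul_le_smul_unit_iff hp hu hp1 (hV.gaugeM_nonneg hu hv hV.unit_mem_interior)).1 h1
  have h0T : (0 : ℝ) ∈ T := by
    change (0 : ℝ) • p ≤ v
    rwa [zero_smul]
  have hc0 : 0 ≤ sSup T := le_csSup hbdd h0T
  have hle : sSup T • p ≤ v := by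
    refine hV.le_of_forall_pos_le_add_smul (x := p) fun ε hε => ?_
    obtain ⟨c, hc, hc'⟩ := exists_lt_of_lt_csSup ⟨0, h0T⟩ (sub_lt_self (sSup T) hε)
    have h1 : sSup T • p ≤ (c + ε) • p := real_smul_le_smul_right (by linarith) hp
    rw [add_smul] at h1
    exact h1.trans (add_le_add_left hc _)
  refine ⟨sSup T, hc0, ?_⟩
  by_contra hne
  have hw0 : v - sSup T • p ≠ 0 := sub_ne_zero.2 hne
  have hw : 0 ≤ v - sSup T • p := sub_nonneg.2 hle
  have h1 := hΨ.gaugeM_smul_le_of_le hV hW hΨu hψ hpψ hw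
    ((sub_le_self v (smul_nonneg hc0 hp)).trans hvp)
  have h2 := hV.gaugeM_pos hu hw hw0 hV.unit_mem_interior
  have h3 : gaugeM (v - sSup T • p) u + sSup T ∈ T := by
    change (_ + _ : ℝ) • p ≤ v
    rw [add_smul]
    exact le_sub_iff_add_le.1 h1
  have := le_csSup hbdd h3
  linarith

/-- A pure state exposed by `q` yields an atom `p' ≤ p`; extremality and the common normalisation
give `p' = p`. -/
theorem exists_pureState_of_corresponds (hΨ : IsGaugeReversing Ψ) (hV : IsOrderUnitSpace u)
    (hW : IsOrderUnitSpace e) (hΨu : Ψ ⟨u, hV.unit_mem_interior⟩ = ⟨e, hW.unit_mem_interior⟩)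
    (hsc : ConeEqConeSc u) {p : V} (hp : p ∈ coneAtoms u) {q : W} (hq : q ∈ coneAtoms e)
    (hpq : Corresponds Ψ u e p q) :
    ∃ ψ ∈ pureStates e, ψ q = 1 ∧ ∀ x : ConeInterior V, gaugeM p (x : V) = ψ (Ψ x : W) := by
  have hu := hV.unit_ne_zero hp.1.1
  have he := hW.unit_ne_zero hq.1.1
  obtain ⟨ψ, hψ, hψq⟩ := hW.exists_pureState_apply_eq_one hq.1.1 hq.2
  have hle : ∀ x : ConeInterior V, ψ (Ψ x : W) ≤ gaugeM p (x : V) := by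
    intro x
    -- Since `ψ (Ψ (u + t p)) = 1 / (t + 1)`, gauge reversal gives `(t + 1) ψ(Ψ x) ≤ M(u/x) + t
    -- M(p/x)`; large `t` then decides.
    have hkey : ∀ t : ℝ, 0 < t → t * (ψ (Ψ x : W) - gaugeM p (x : V)) ≤ gaugeM u (x : V) := by
      intro t ht
      obtain ⟨hmem, hΨt⟩ := hpq t (by linarith)
      have h1 : gaugeM (u + t • p) (x : V) ≤ gaugeM u (x : V) + t * gaugeM p (x : V) := by
        rw [← hV.gaugeM_smul hu p x.2 ht]
        exact hV.gaugeM_add_le hu _ _ x.2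
      have h2 := hΨ ⟨_, hmem⟩ x
      change gaugeM (u + t • p) (x : V) = _ at h2
      have h3 := IsOrderUnitSpace.state_mono hψ.1
        (hW.le_gaugeM_smul he (Ψ x : W) (Ψ ⟨_, hmem⟩).2)
      rw [← h2, hΨt, _root_.map_smul, map_sub, _root_.map_smul, hψ.1.2, hψq, smul_eq_mul,
        smul_eq_mul, mul_one] at h3
      have h4 : 1 - t / (t + 1) = (t + 1)⁻¹ := by field_simp; ring
      rw [h4, ← div_eq_mul_inv, le_div_iff₀ (by linarith)] at h3
      have h5 := hW.state_pos hψ.1 (Ψ x).2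
      linarith
    by_contra! hlt
    have hd : 0 < ψ (Ψ x : W) - gaugeM p (x : V) := sub_pos.2 hlt
    have hg := hV.gaugeM_nonneg hu hV.orderUnit.1 x.2
    have h6 := hkey ((gaugeM u (x : V) + 1) / (ψ (Ψ x : W) - gaugeM p (x : V))) (by positivity)
    rw [div_mul_cancel₀ _ hd.ne'] at h6
    linarith
  obtain ⟨p', hp', hp'ψ⟩ := hΨ.exists_gaugeM_eq_pureState hV hW hΨu hsc hψ
  have hp'p : p' ≤ p := hV.le_of_gaugeM_le hu hp.1.2.1 fun x hx => by
    rw [hp'ψ ⟨x, hx⟩]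
    exact hle ⟨x, hx⟩
  have hp'a := hΨ.mem_coneAtoms_of_pureState hV hW hΨu hψ hp' hp'ψ
  obtain ⟨l, hl⟩ := hp.1.exists_eq_smul_of_le hp' hp'a.1.1 hp'p
  have heq : p = p' := by
    have h1 := hp.2
    have hi := hV.unit_mem_interior
    have hl0 : 0 < l := by
      by_contra! hl0
      have h2 : l • p' ≤ (0 : ℝ) • p' := real_smul_le_smul_right hl0 hp'
      rw [← hl, zero_smul] at h2
      exact hp.1.1 (le_antisymm h2 hp.1.2.1)
    rw [hl, hV.gaugeM_smul hu _ hi hl0, hp'a.2, mul_one] at h1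
    rw [hl, h1, one_smul]
  exact ⟨ψ, hψ, hψq, fun x => by rw [heq, hp'ψ]⟩

end IsGaugeReversing

end PureStates

theorem theoremT
    {V : Type*} [NormedAddCommGroup V] [NormedSpace ℝ V] [CompleteSpace V]
    [PartialOrder V] [IsOrderedAddMonoid V] [PosSMulMono ℝ V]
    {W : Type*} [NormedAddCommGroup W] [NormedSpace ℝ W] [CompleteSpace W]
    [PartialOrder W] [IsOrderedAddMonoid W] [PosSMulMono ℝ W]
    (u : V) (hV : IsOrderUnitSpace u) (e : W) (hW : IsOrderUnitSpace e)
    (hsc : ConeEqConeSc u)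
    (Ψ : ConeInterior V ≃ ConeInterior W) (hΨ : IsGaugeReversing Ψ)
    (hΨu : Ψ ⟨u, hV.unit_mem_interior⟩ = ⟨e, hW.unit_mem_interior⟩) :
    ∃ (A : coneAtoms u ≃ coneAtoms e) (Ψstar : coneAtoms u ≃ pureStates e),
      (∀ (p : coneAtoms u) (q : coneAtoms e),
        A p = q ↔ Corresponds Ψ u e (p : V) (q : W)) ∧
      (∀ (p : coneAtoms u) (ψ : pureStates e),
        Ψstar p = ψ ↔ IsPsiStar Ψ (p : V) (ψ : WeakDual ℝ W)) ∧
      (∀ (p : coneAtoms u) (x : ConeInterior V),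
        gaugeM (p : V) (x : V) = (Ψstar p : WeakDual ℝ W) (Ψ x : W)) ∧
      (∀ p : coneAtoms u, (Ψstar p : WeakDual ℝ W) (A p : W) = 1) := by
  have hA := corresponds_atomEquiv hΨ hV hW hΨu
  set A := atomEquiv hΨ hV hW hΨu
  have hS : ∀ p : coneAtoms u, ∃ ψ : pureStates e, (ψ : WeakDual ℝ W) (A p : W) = 1 ∧
      ∀ x : ConeInterior V, gaugeM (p : V) (x : V) = (ψ : WeakDual ℝ W) (Ψ x : W) := fun p =>
    let ⟨ψ, hψ, h⟩ := hΨ.exists_pureState_of_corresponds hV hW hΨu hsc p.2 (A p).2 (hA p)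
    ⟨⟨ψ, hψ⟩, h⟩
  choose S hS1 hS2 using hS
  have hext : ∀ (p : coneAtoms u) (ψ : pureStates e),
      (∀ x : ConeInterior V, gaugeM (p : V) (x : V) = (ψ : WeakDual ℝ W) (Ψ x : W)) →
      S p = ψ := fun p ψ h => Subtype.ext (hW.state_ext (S p).2.1 ψ.2.1 fun y hy => by
    have h1 := hS2 p (Ψ.symm ⟨y, hy⟩)
    have h2 := h (Ψ.symm ⟨y, hy⟩)
    rw [Equiv.apply_symm_apply] at h1 h2
    exact h1.symm.trans h2)
  have hbij : Function.Bijective S := by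
    constructor
    · intro p p' h
      have hu := hV.unit_ne_zero p.2.1.1
      have heq : ∀ x (hx : x ∈ interior (posCone V)), gaugeM (p : V) x = gaugeM (p' : V) x :=
        fun x hx => by rw [hS2 p ⟨x, hx⟩, hS2 p' ⟨x, hx⟩, h]
      exact Subtype.ext (le_antisymm
        (hV.le_of_gaugeM_le hu p'.2.1.2.1 fun x hx => (heq x hx).le)
        (hV.le_of_gaugeM_le hu p.2.1.2.1 fun x hx => (heq x hx).ge))
    · intro ψ
      obtain ⟨p, hp, hpψ⟩ := hΨ.exists_gaugeM_eq_pureState hV hW hΨu hsc ψ.2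
      exact ⟨⟨p, hΨ.mem_coneAtoms_of_pureState hV hW hΨu ψ.2 hp hpψ⟩, hext _ _ hpψ⟩
  refine ⟨A, Equiv.ofBijective S hbij, fun p q => ?_, fun p ψ => ?_, hS2, hS1⟩
  · exact ⟨fun h => h ▸ hA p, fun h => Subtype.ext ((hA p).eq h)⟩
  · change S p = ψ ↔ _
    constructor
    · rintro rfl y
      change Real.log (gaugeM (p : V) (Ψ.symm y : V)) = _
      rw [hS2, Equiv.apply_symm_apply]
    · intro h
      refine hext p ψ fun x => ?_
      have h1 := h (Ψ x)
      change Real.log (gaugeM (p : V) (Ψ.symm (Ψ x) : V)) = _ at h1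
      rw [Equiv.symm_apply_apply] at h1
      -- `Real.log` is injective only on positive reals, so both values must be positive.
      exact Real.log_injOn_pos
        (hV.gaugeM_pos (hV.unit_ne_zero p.2.1.1) p.2.1.2.1 p.2.1.1 x.2)
        (hW.state_pos ψ.2.1 (Ψ x).2) h1
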